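/- Let $\mathbb{R}^+=(0,\infty)$. Let $\mathscr{F}$ be the unitary Fourier operator on $L^2(\mathbb{R})$ determined by $$(\mathscr{F}x)(t)=\frac{1}{\sqrt{2\pi}}\int_{\mathbb{R}}x(\xi)e^{it\xi}\,d\xi ,\qquad x\in L^1(\mathbb{R})\cap L^2(\mathbb{R}),$$ and let $\mathscr{F}_{\mathbb{R}^+}\colon L^2(\mathbb{R}^+)\to L^2(\mathbb{R}^+)$ be its truncation: extend $x\in L^2(\mathbb{R}^+)$ by zero to $\mathbb{R}$, apply $\mathscr{F}$, and restrict the result to $\mathbb{R}^+$. Thus $(\mathscr{F}_{\mathbb{R}^+}x)(t)=\frac{1}{\sqrt{2\pi}}\int_{\mathbb{R}^+}x(\xi)e^{it\xi}\,d\xi$ for almost every $t\in\mathbb{R}^+$ whenever $x\in L^1(\mathbb{R}^+)\cap L^2(\mathbb{R}^+)$. Let $\mathscr{F}_{\mathbb{R}^+}^{*}$ be the Hilbert space adjoint of $\mathscr{F}_{\mathbb{R}^+}$. For a bounded operator $A$ on a complex Hilbert space $\mathscr{H}$ with spectrum $\sigma(A)$, let - $\sigma_p(A)$, the point spectrum,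 be the set of $\lambda\in\sigma(A)$ for which $\lambda I-A$ is not one-to-one; - $\sigma_r(A)$, the residual spectrum, be the set of $\lambda\in\sigma(A)$ for which the range of $\lambda I-A$ is not dense in $\mathscr{H}$; - $\sigma_c(A)$, the continuous spectrum, be the set of $\lambda\in\sigma(A)$ for which $\lambda I-A$ is one-to-one with dense range, but the inverse $(\lambda I-A)^{-1}$, defined on this range, is unbounded. For $a,b\in\mathbb{C}$ let $[a,b]=\{(1-\tau)a+\tau b:0\le\tau\le1\}$. **Theorem.** 1. $\sigma(\mathscr{F}_{\mathbb{R}^+})=[-2^{-1/2}e^{i\pi/4},\,2^{-1/2}e^{i\pi/4}]$. Moreover $\sigma_p(\mathscr{F}_{\mathbb{R}^+})=\emptyset$ and $\sigma_r(\mathscr{F}_{\mathbb{R}^+})=\emptyset$, and $\sigma(\mathscr{F}_{\mathbb{R}^+})=\sigma_c(\mathscr{F}_{\mathbb{R}^+})$. 2. $\sigma(\mathscr{F}_{\mathbb{R}^+}^{*})=[-2^{-1/2}e^{-i\pi/4},\,2^{-1/2}e^{-i\pi/4}]$. Moreover $\sigma_p(\mathscr{F}_{\mathbb{R}^+}^{*})=\emptyset$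 and $\sigma_r(\mathscr{F}_{\mathbb{R}^+}^{*})=\emptyset$, and $\sigma(\mathscr{F}_{\mathbb{R}^+}^{*})=\sigma_c(\mathscr{F}_{\mathbb{R}^+}^{*})$. -/

import Mathlib

open MeasureTheory FourierTransform
open scoped ContDiff

noncomputable section

/-- The Hilbert space `L²(ℝ)` of complex valued functions, with Lebesgue measure. -/
abbrev L2Real : Type := Lp ℂ 2 (volume : Measure ℝ)

/-- The Hilbert space `L²(ℝ⁺)` of complex valued functions on `ℝ⁺ = (0, ∞)`, with Lebesgue
measure. -/
abbrev L2Pos : Type := Lp ℂ 2 (volume.restrict (Set.Ioi (0 : ℝ)))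

/-! ### The rescaling that turns Mathlib's Fourier kernel into `e^{itξ} / √(2π)` -/

theorem map_scale : Measure.map (fun t : ℝ => (2 * Real.pi)⁻¹ * t) volume
    = ((2 * Real.pi).toNNReal) • (volume : Measure ℝ) := by
  have h := Real.map_volume_mul_left (a := (2 * Real.pi)⁻¹) (by positivity)
  rw [inv_inv, abs_of_pos (by positivity : (0 : ℝ) < 2 * Real.pi)] at h
  exact h

theorem quasiMeasurePreserving_scale :
    Measure.QuasiMeasurePreserving (fun t : ℝ => (2 * Real.pi)⁻¹ * t) volume volume := by
  refine ⟨by fun_prop, ?_⟩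
  rw [map_scale]
  exact Measure.smul_absolutelyContinuous

theorem memLp_scale (g : L2Real) :
    MemLp (fun t : ℝ => ((Real.sqrt (2 * Real.pi))⁻¹ : ℂ) * g ((2 * Real.pi)⁻¹ * t)) 2 volume := by
  refine MemLp.const_mul ?_ _
  have h : MemLp g 2 (Measure.map (fun t : ℝ => (2 * Real.pi)⁻¹ * t) volume) := by
    rw [map_scale]
    exact (Lp.memLp g).smul_measure ENNReal.coe_ne_top
  exact h.comp_of_map (by fun_prop)

theorem eLpNorm_scale (g : L2Real) :
    eLpNorm (fun t : ℝ => ((Real.sqrt (2 * Real.pi))⁻¹ : ℂ) * g ((2 * Real.pi)⁻¹ * t)) 2 volume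
      = eLpNorm g 2 volume := by
  have h1 : eLpNorm (fun t : ℝ => g ((2 * Real.pi)⁻¹ * t)) 2 volume
      = eLpNorm g 2 (Measure.map (fun t : ℝ => (2 * Real.pi)⁻¹ * t) volume) := by
    rw [eLpNorm_map_measure _ (by fun_prop)]
    · rfl
    · rw [map_scale]
      exact (Lp.aestronglyMeasurable g).smul_measure _
  have h2 := eLpNorm_const_smul ((Real.sqrt (2 * Real.pi))⁻¹ : ℂ)
    (fun t : ℝ => g ((2 * Real.pi)⁻¹ * t)) 2 volume
  have h3 : (fun t : ℝ => ((Real.sqrt (2 * Real.pi))⁻¹ : ℂ) * g ((2 * Real.pi)⁻¹ * t))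
      = ((Real.sqrt (2 * Real.pi))⁻¹ : ℂ) • (fun t : ℝ => g ((2 * Real.pi)⁻¹ * t)) := by
    ext t; simp
  rw [h3, h2, h1, map_scale, eLpNorm_smul_measure_of_ne_top' (by norm_num),
    ENNReal.smul_def, smul_eq_mul, ← mul_assoc]
  have hpi : (0 : ℝ) < 2 * Real.pi := by positivity
  have h4 : ‖((Real.sqrt (2 * Real.pi))⁻¹ : ℂ)‖ₑ
      * (((2 * Real.pi).toNNReal ^ (ENNReal.toReal 2)⁻¹ : NNReal) : ENNReal) = 1 := by
    rw [← ofReal_norm, norm_inv, Complex.norm_real, Real.norm_eq_abs,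
      abs_of_nonneg (Real.sqrt_nonneg _), ENNReal.ofReal, ← ENNReal.coe_mul,
      ENNReal.coe_eq_one]
    apply NNReal.eq
    rw [NNReal.coe_mul, Real.coe_toNNReal _ (by positivity), NNReal.coe_rpow,
      Real.coe_toNNReal _ hpi.le, NNReal.coe_one, Real.sqrt_eq_rpow]
    norm_num
    exact inv_mul_cancel₀ (by positivity)
  rw [h4, one_mul]

/-- The unitary rescaling `g ↦ (t ↦ (2π)^{-1/2} g(t / (2π)))` of `L²(ℝ)`. -/
def scaleL2 : L2Real →ₗᵢ[ℂ] L2Real where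
  toFun g := (memLp_scale g).toLp _
  map_add' f g := by
    rw [← MemLp.toLp_add]
    apply MemLp.toLp_congr
    filter_upwards [quasiMeasurePreserving_scale.ae (Lp.coeFn_add f g)] with t ht
    simp only [ht, Pi.add_apply, mul_add]
  map_smul' c g := by
    rw [RingHom.id_apply, ← MemLp.toLp_const_smul]
    apply MemLp.toLp_congr
    filter_upwards [quasiMeasurePreserving_scale.ae (Lp.coeFn_smul c g)] with t ht
    simp only [ht, Pi.smul_apply, smul_eq_mul]
    ring
  norm_map' g := by
    change ‖(memLp_scale g).toLp _‖ = ‖g‖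
    rw [Lp.norm_toLp, eLpNorm_scale, Lp.norm_def]

/-- The Fourier operator on `L²(ℝ)`, `(𝓕 x)(t) = (2π)^{-1/2} ∫ x(ξ) e^{itξ} dξ`: the rescaling of
Mathlib's `L²` transform `𝓕⁻` with kernel `e^{2πitξ}`. -/
def fourierOp : L2Real →L[ℂ] L2Real :=
  scaleL2.toContinuousLinearMap ∘L
    ((Lp.fourierTransformₗᵢ ℝ ℂ).symm.toContinuousLinearEquiv : L2Real →L[ℂ] L2Real)

/-! ### Truncation -/

theorem memLp_extend (x : L2Pos) : MemLp ((Set.Ioi (0 : ℝ)).indicator x) 2 volume :=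
  (memLp_indicator_iff_restrict measurableSet_Ioi).2 (Lp.memLp x)

/-- The natural embedding `L²(ℝ⁺) ⊆ L²(ℝ)`, extension by zero. -/
def extendL2 : L2Pos →ₗᵢ[ℂ] L2Real where
  toFun x := (memLp_extend x).toLp _
  map_add' x y := by
    rw [← MemLp.toLp_add]
    apply MemLp.toLp_congr
    filter_upwards [(ae_restrict_iff' measurableSet_Ioi).1 (Lp.coeFn_add x y)] with t ht
    by_cases h : t ∈ Set.Ioi (0 : ℝ)
    · simp only [Set.indicator_of_mem h, Pi.add_apply, ht h]
    · simp only [Set.indicator_of_notMem h, Pi.add_apply, add_zero]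
  map_smul' c x := by
    rw [RingHom.id_apply, ← MemLp.toLp_const_smul]
    apply MemLp.toLp_congr
    filter_upwards [(ae_restrict_iff' measurableSet_Ioi).1 (Lp.coeFn_smul c x)] with t ht
    by_cases h : t ∈ Set.Ioi (0 : ℝ)
    · simp only [Set.indicator_of_mem h, Pi.smul_apply, ht h]
    · simp only [Set.indicator_of_notMem h, Pi.smul_apply, smul_zero]
  norm_map' x := by
    change ‖(memLp_extend x).toLp _‖ = ‖x‖
    rw [Lp.norm_toLp, eLpNorm_indicator_eq_eLpNorm_restrict measurableSet_Ioi, Lp.norm_def]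

/-- The restriction `L²(ℝ) → L²(ℝ⁺)`. -/
def restrictL2 : L2Real →L[ℂ] L2Pos :=
  LpToLpRestrictCLM ℝ ℂ ℂ volume 2 (Set.Ioi 0)

/-- The Fourier operator truncated on the positive half-axis: the compression to `L²(ℝ⁺)` of the
Fourier operator on `L²(ℝ)`. -/
def truncatedFourier : L2Pos →L[ℂ] L2Pos :=
  restrictL2 ∘L fourierOp ∘L extendL2.toContinuousLinearMap

/-- On `L²(ℝ)`, the inverse transform of an integrable function is given by the integral. -/
theorem fourierInv_ae (f : L2Real) (hf : Integrable f) :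
    ((𝓕⁻ f : L2Real) : ℝ → ℂ) =ᵐ[volume] 𝓕⁻ (f : ℝ → ℂ) := by
  have hcont : Continuous (𝓕⁻ (f : ℝ → ℂ)) :=
    VectorFourier.fourierIntegral_continuous Real.continuous_fourierChar
      (by exact continuous_inner.neg) hf
  refine ae_eq_of_integral_contDiff_smul_eq
    ((Lp.memLp (𝓕⁻ f : L2Real)).locallyIntegrable (by norm_num)) hcont.locallyIntegrable ?_
  intro g g_smooth g_cpt
  have hg₁ : HasCompactSupport (Complex.ofRealCLM ∘ g) := g_cpt.comp_left rfl
  have hg₂ : ContDiff ℝ ∞ (Complex.ofRealCLM ∘ g) := by fun_prop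
  have h1 := congrArg (fun u => u (hg₁.toSchwartzMap hg₂))
    (Lp.fourierInv_toTemperedDistribution_eq f)
  simp only [TemperedDistribution.fourierInv_apply, Lp.toTemperedDistribution_apply,
    SchwartzMap.fourierInv_coe] at h1
  have h2 := VectorFourier.integral_fourierIntegral_smul_eq_flip (L := -innerₗ ℝ)
    (μ := volume) (ν := volume) (f := hg₁.toSchwartzMap hg₂) (g := f)
    Real.continuous_fourierChar (by exact continuous_inner.neg)
    (hg₁.toSchwartzMap hg₂).integrable hf
  have h3 : (-innerₗ ℝ : ℝ →ₗ[ℝ] ℝ →ₗ[ℝ] ℝ).flip = -innerₗ ℝ := by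
    ext; simp
  rw [h3] at h2
  have h4 := h1.symm.trans h2
  simpa using! h4

/-- For integrable `x ∈ L²(ℝ⁺)` the truncated Fourier operator is given by the integral
`(2π)^{-1/2} ∫_{ℝ⁺} x(ξ) e^{itξ} dξ`; as such `x` are dense, this determines the operator. -/
theorem truncatedFourier_ae (x : L2Pos) (hx : Integrable x (volume.restrict (Set.Ioi 0))) :
    truncatedFourier x =ᵐ[volume.restrict (Set.Ioi 0)] fun t : ℝ =>
      ((Real.sqrt (2 * Real.pi))⁻¹ : ℂ) *
        ∫ ξ in Set.Ioi (0 : ℝ), x ξ * Complex.exp (Complex.I * t * ξ) := by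
  have hext : (extendL2 x : ℝ → ℂ) =ᵐ[volume] (Set.Ioi (0 : ℝ)).indicator x :=
    (memLp_extend x).coeFn_toLp
  have hint : Integrable (extendL2 x) :=
    ((integrable_indicator_iff measurableSet_Ioi).2 hx).congr hext.symm
  have h1 : truncatedFourier x =ᵐ[volume.restrict (Set.Ioi 0)] fourierOp (extendL2 x) :=
    LpToLpRestrictCLM_coeFn ℂ (Set.Ioi 0) (fourierOp (extendL2 x))
  have h2 : fourierOp (extendL2 x) =ᵐ[volume] fun t : ℝ => ((Real.sqrt (2 * Real.pi))⁻¹ : ℂ) *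
      (𝓕⁻ (extendL2 x) : L2Real) ((2 * Real.pi)⁻¹ * t) :=
    (memLp_scale (𝓕⁻ (extendL2 x))).coeFn_toLp
  filter_upwards [h1, ae_restrict_of_ae h2, ae_restrict_of_ae
    (quasiMeasurePreserving_scale.ae (fourierInv_ae (extendL2 x) hint))] with t ht1 ht2 ht3
  rw [ht1, ht2, ht3, Real.fourierInv_eq', ← integral_indicator measurableSet_Ioi]
  congr 1
  refine integral_congr_ae ?_
  filter_upwards [hext] with v hv
  rw [hv]
  by_cases h : v ∈ Set.Ioi (0 : ℝ)
  · rw [Set.indicator_of_mem h, Set.indicator_of_mem h, smul_eq_mul, mul_comm]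
    congr 2
    have : (Real.pi : ℂ) ≠ 0 := by exact_mod_cast Real.pi_ne_zero
    simp only [RCLike.inner_apply, conj_trivial]
    push_cast
    field_simp
  · rw [Set.indicator_of_notMem h, Set.indicator_of_notMem h, smul_zero]

/-! ### Parts of the spectrum of a bounded operator on a Hilbert space -/

section Spectrum

variable {H : Type*} [NormedAddCommGroup H] [InnerProductSpace ℂ H]

/-- The point spectrum: the `z` in the spectrum for which `z - A` is not one-to-one. -/
def pointSpectrum (A : H →L[ℂ] H) : Set ℂ :=
  {z | z ∈ spectrum ℂ A ∧ ¬ Function.Injective fun x : H => z • x - A x}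

/-- The residual spectrum: the `z` in the spectrum for which the range of `z - A` is not dense. -/
def residualSpectrum (A : H →L[ℂ] H) : Set ℂ :=
  {z | z ∈ spectrum ℂ A ∧ ¬ DenseRange fun x : H => z • x - A x}

/-- The continuous spectrum: the `z` in the spectrum for which `z - A` is one-to-one with dense
range, but the inverse `(z - A)⁻¹`, defined on that range, is unbounded. -/
def continuousSpectrum (A : H →L[ℂ] H) : Set ℂ :=
  {z | z ∈ spectrum ℂ A ∧ (Function.Injective fun x : H => z • x - A x) ∧
    (DenseRange fun x : H => z • x - A x) ∧ ¬ ∃ C : ℝ, ∀ x : H, ‖x‖ ≤ C * ‖z • x - A x‖}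

end Spectrum

end

/-! Write `A` for the truncated Fourier operator. Its square is explicit: applying the kernel
`e^{itξ}` twice on the half-line gives `∫₀^∞ e^{iu(s+v)} du = i / (s + v)` in the sense of Abel, so
`A² = i B` with `B` the Carleman operator of kernel `1 / (2π (s + v))`. This kernel is homogeneous
of degree `-1`. The substitution `t = e^u` therefore makes it a convolution, and the Mellin
transform turns `B` into multiplication by `1 / (2 cosh (2π² v))`. Hence `B` is positive with
spectrum `[0, 1/2]`, and it has no eigenvector because the symbol takes each value at no more than
two points.

By spectral mapping `σ(A)` lies in the set of square roots of `i [0, 1/2]`, which is the required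
segment. The difficulty is to show that both square roots occur. Two relations inherited from the
full line decide it: the Fourier operator is unitary and its square is the reflection, whence `A*A +
AA* = 1`, while `A*² = -iB = -A²`. They force `T = A*A - AA*` to anticommute with `A` and to satisfy
`T² = 1 + 4A⁴`. Thus `T` intertwines `A` with `-A`, and where `1 + 4z⁴ ≠ 0` a resolvent of `A` at
`z` alone already yields a resolvent of `A²` at `z²` (`sq_notMem_spectrum_sq`). On the segment the
only exceptions are the endpoints, which are recovered because the spectrum is closed.

An eigenvector of `A` or of `A*` would be one of `B`. Hence every `z - A` is injective, and its
range is dense since the orthogonal complement is a kernel of the adjoint. The whole spectrum is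
then continuous. All hypotheses are symmetric in `A` and `A*`, so the second half needs no new
argument. -/

noncomputable section

/-! ### The anticommuting element and square roots in the spectrum -/

section Algebra

variable {R : Type*} [Ring R]

/-- The sum telescopes to `b a² - a² b`, and `a² = -b²` commutes with `b`. -/
theorem commutator_mul_self_add {a b : R} (h2 : b * b = -(a * a)) :
    (b * a - a * b) * a + a * (b * a - a * b) = 0 := by
  have h3 : b * (a * a) = a * a * b := by
    have : a * a = -(b * b) := by rw [h2, neg_neg]
    rw [this]; noncomm_ring
  calc (b * a - a * b) * a + a * (b * a - a * b) = b * (a * a) - a * a * b := by noncomm_ring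
    _ = 0 := by rw [h3, sub_self]

/-- The square of the commutator differs from that of the anticommutator by `2 (b a² b + a b² a)`,
and each of these two products equals `-a⁴`. -/
theorem commutator_sq {a b : R} (h1 : b * a + a * b = 1) (h2 : b * b = -(a * a)) :
    (b * a - a * b) * (b * a - a * b) = 1 + 4 * (a * a * (a * a)) := by
  have h2' : a * a = -(b * b) := by rw [h2, neg_neg]
  have e1 : b * (a * a) * b = -(a * a * (a * a)) := by
    calc b * (a * a) * b = b * (-(b * b)) * b := by rw [← h2']
      _ = -((b * b) * (b * b)) := by noncomm_ring
      _ = _ := by rw [h2]; noncomm_ring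
  have e2 : a * (b * b) * a = -(a * a * (a * a)) := by rw [h2]; noncomm_ring
  calc (b * a - a * b) * (b * a - a * b)
      = (b * a + a * b) * (b * a + a * b) - 2 * (b * (a * a) * b) - 2 * (a * (b * b) * a) := by
        noncomm_ring
    _ = _ := by rw [h1, e1, e2]; noncomm_ring

/-- Only `z - a` is assumed invertible, although `z² - a² = (z - a)(z + a)`. The commutator `t`
supplies the other factor: it intertwines `z + a` with `z - a`, and its square is a polynomial in
`a²`, so an inverse of `z² - a²` can be assembled from `t` and `(z - a)⁻¹`. -/
theorem sq_notMem_spectrum_sq [Algebra ℂ R] {a b : R} (h1 : b * a + a * b = 1) (h2 : b * b = -(a * a)) {z : ℂ}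
    (hz : z ∉ spectrum ℂ a) (hz4 : 1 + 4 * z ^ 4 ≠ 0) : z ^ 2 ∉ spectrum ℂ (a * a) := by
  obtain ⟨t, hta, htt⟩ : ∃ t : R, t * a = -(a * t) ∧ t * t = 1 + 4 * (a * a * (a * a)) :=
    ⟨b * a - a * b, eq_neg_of_add_eq_zero_left (commutator_mul_self_add h2), commutator_sq h1 h2⟩
  rw [spectrum.notMem_iff] at hz ⊢
  obtain ⟨u, hu⟩ := hz
  set w := algebraMap ℂ R z with hw
  have hwc : ∀ x : R, w * x = x * w := fun x => Algebra.commutes z x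
  set g : R := ((u⁻¹ : Rˣ) : R) with hg
  have hug : (w - a) * g = 1 := by rw [← hu]; exact u.mul_inv
  have hgu : g * (w - a) = 1 := by rw [← hu]; exact u.inv_mul
  have hw2 : algebraMap ℂ R (z ^ 2) = w * w := by rw [map_pow, pow_two]
  rw [hw2]
  obtain ⟨n, hn⟩ : ∃ n, n = w * w - a * a := ⟨_, rfl⟩
  rw [← hn]
  have hnl : n = (w + a) * (w - a) := by
    have := hwc a
    calc n = w * w - a * a + (a * w - w * a) := by rw [this, hn, sub_self, add_zero]
      _ = _ := by noncomm_ring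
  have hnr : n = (w - a) * (w + a) := by
    have := hwc a
    calc n = w * w - a * a + (w * a - a * w) := by rw [this, hn, sub_self, add_zero]
      _ = _ := by noncomm_ring
  have hng : n * g = w + a := by rw [hnl, mul_assoc, hug, mul_one]
  have hgn : g * n = w + a := by rw [hnr, ← mul_assoc, hgu, one_mul]
  have hwt : (w + a) * t = t * (w - a) := by
    rw [add_mul, mul_sub, hwc t, hta, sub_neg_eq_add]
  -- Here `n g = w + a`, which turns into `w - a` on passing through `t` and is then cancelled by
  -- the last `g`.
  have htg : n * (g * t * g) = t := by
    calc n * (g * t * g) = (n * g) * t * g := by noncomm_ring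
      _ = t * ((w - a) * g) := by rw [hng, hwt, mul_assoc]
      _ = t := by rw [hug, mul_one]
  have hnt : n * t = t * n := by
    have e : t * (a * a) = a * a * t := by
      rw [← mul_assoc, hta, neg_mul, mul_assoc, hta, mul_neg, neg_neg, ← mul_assoc]
    have e' : t * (w * w) = w * w * t := by
      rw [← mul_assoc, ← hwc, mul_assoc, ← hwc, ← mul_assoc]
    rw [hn, sub_mul, mul_sub, e, e']
  have cg : Commute n g := hng.trans hgn.symm
  have ct : Commute n t := hnt
  have cwx : ∀ y : R, Commute w y := hwc
  have ca : Commute n (a * a) :=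
    hn ▸ ((cwx _).mul_left (cwx _)).sub_left (Commute.refl _)
  have cw : Commute n (w * w) := (cwx n).symm.mul_right (cwx n).symm
  -- Multiplied by `n`, the first term gives `t² = 1 + 4a⁴` and the second gives `4w⁴ - 4a⁴`. The
  -- sum is the scalar `1 + 4z⁴`.
  set x := g * t * g * t + 4 * (w * w + a * a) with hx
  have cx : Commute n x :=
    Commute.add_right (((cg.mul_right ct).mul_right cg).mul_right ct)
      (Commute.mul_right (Commute.ofNat_right n 4) (cw.add_right ca))
  have hnx : n * x = algebraMap ℂ R (1 + 4 * z ^ 4) := by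
    have e : w * w * (a * a) = a * a * (w * w) := by
      exact ((cwx _).mul_left (cwx _)).eq
    calc n * x = (n * (g * t * g)) * t + 4 * (n * (w * w + a * a)) := by rw [hx]; noncomm_ring
      _ = 1 + 4 * (a * a * (a * a)) + 4 * ((w * w - a * a) * (w * w + a * a)) := by rw [htg, htt, hn]
      _ = 1 + 4 * (w * w * (w * w)) + 4 * (w * w * (a * a) - a * a * (w * w)) := by noncomm_ring
      _ = 1 + 4 * (w * w * (w * w)) := by rw [e]; noncomm_ring
      _ = _ := by
        rw [map_add, map_one, map_mul, map_pow, map_ofNat, ← hw]; simp only [pow_succ, pow_zero, one_mul, mul_assoc]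
  have hunit : IsUnit (algebraMap ℂ R (1 + 4 * z ^ 4)) := (IsUnit.mk0 _ hz4).map _
  exact (cx.isUnit_mul_iff.1 (hnx ▸ hunit)).1

end Algebra

/-! ### From the square of an operator to its spectrum -/

section Hilbert

open scoped Pointwise

variable {H : Type*} [NormedAddCommGroup H] [InnerProductSpace ℂ H] [CompleteSpace H]

/-- The inclusion in the segment is spectral mapping for the square. Conversely, at `z = s e` the
obstruction `1 + 4z⁴` equals `1 - s⁴`, so `sq_notMem_spectrum_sq` applies to both signs of `s` when
`|s| < 1`. -/
theorem spectrum_eq_segment {A B : H →L[ℂ] H} {e : ℂ} (he : e ^ 4 = -1 / 4)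
    (hAB : A * A = (2 * e ^ 2) • B)
    (h1 : star A * A + A * star A = 1) (h2 : star A * star A = -(A * A))
    (hB : spectrum ℂ B = (fun c : ℝ => (c : ℂ)) '' Set.Icc 0 (1 / 2)) :
    spectrum ℂ A = segment ℝ (-e) e := by
  have he0 : e ≠ 0 := by rintro rfl; norm_num at he
  have hk : (2 * e ^ 2) ≠ 0 := by simp [he0]
  have hsq : ∀ z : ℂ, z ∈ spectrum ℂ (A * A) ↔ ∃ c ∈ Set.Icc (0 : ℝ) (1 / 2),
      z = 2 * e ^ 2 * c := by
    intro z
    have : spectrum ℂ (A * A) = (2 * e ^ 2) • spectrum ℂ B := by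
      rw [hAB]
      exact spectrum.unit_smul_eq_smul B (Units.mk0 _ hk)
    rw [this, hB]
    constructor
    · rintro ⟨_, ⟨c, hc, rfl⟩, rfl⟩
      exact ⟨c, hc, rfl⟩
    · rintro ⟨c, hc, rfl⟩
      exact ⟨_, ⟨c, hc, rfl⟩, rfl⟩
  have hseg : ∀ z : ℂ, z ∈ segment ℝ (-e) e ↔ ∃ s ∈ Set.Icc (-1 : ℝ) 1, z = s * e := by
    intro z
    rw [segment_eq_image_lineMap]
    constructor
    · rintro ⟨r, hr, rfl⟩
      refine ⟨2 * r - 1, ⟨by linarith [hr.1], by linarith [hr.2]⟩, ?_⟩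
      simp [AffineMap.lineMap_apply]; ring
    · rintro ⟨s, hs, rfl⟩
      refine ⟨(s + 1) / 2, ⟨by linarith [hs.1], by linarith [hs.2]⟩, ?_⟩
      simp [AffineMap.lineMap_apply]; ring
  have hopen : ∀ s : ℝ, s ∈ Set.Ioo (-1 : ℝ) 1 → (s : ℂ) * e ∈ spectrum ℂ A := by
    intro s hs
    by_contra hcon
    have hs2 : s ^ 2 < 1 := by nlinarith [hs.1, hs.2]
    -- The witness comes from `(s e)² = 2e² · (s² / 2)`.
    refine sq_notMem_spectrum_sq h1 h2 hcon ?_ ((hsq _).2 ⟨s ^ 2 / 2, ⟨by positivity, by linarith⟩,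
      by push_cast; ring⟩)
    rw [mul_pow, he]
    have : (1 : ℂ) + 4 * ((s : ℂ) ^ 4 * (-1 / 4)) = ((1 - s ^ 4 : ℝ) : ℂ) := by push_cast; ring
    rw [this]
    norm_cast
    nlinarith [sq_nonneg s]
  ext z
  rw [hseg]
  constructor
  · intro hz
    have hz2 : z ^ 2 ∈ spectrum ℂ (A * A) := by
      rw [← pow_two]; exact spectrum.pow_mem_pow A 2 hz
    obtain ⟨c, hc, hzc⟩ := (hsq _).1 hz2
    have hs1 : Real.sqrt (2 * c) ≤ 1 := Real.sqrt_le_one.2 (by linarith [hc.2])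
    have hs0 := Real.sqrt_nonneg (2 * c)
    have hss : ((Real.sqrt (2 * c) : ℝ) : ℂ) ^ 2 = 2 * c := by
      rw [← Complex.ofReal_pow, Real.sq_sqrt (by linarith [hc.1])]; push_cast; ring
    have : z ^ 2 = (Real.sqrt (2 * c) * e) ^ 2 := by rw [hzc, mul_pow, hss]; ring
    rcases sq_eq_sq_iff_eq_or_eq_neg.1 this with h | h
    · exact ⟨_, ⟨by linarith, hs1⟩, h⟩
    · exact ⟨-Real.sqrt (2 * c), ⟨by linarith, by linarith⟩, by rw [h]; push_cast; ring⟩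
  · rintro ⟨s, hs, rfl⟩
    -- At `s = ±1` the obstruction vanishes, so the endpoints are reached as limits.
    have hcl : IsClosed ((fun s : ℝ => (s : ℂ) * e) ⁻¹' spectrum ℂ A) :=
      (spectrum.isClosed A).preimage (by fun_prop)
    have := hcl.closure_subset_iff.2 hopen
    rw [closure_Ioo (by norm_num)] at this
    exact this hs

/-- The lower bound makes the range closed, hence everything, and the bounded inverse theorem
applies. -/
theorem isUnit_of_denseRange_of_le {A : H →L[ℂ] H} (hd : DenseRange A) {C : ℝ}
    (hC : ∀ x, ‖x‖ ≤ C * ‖A x‖) : IsUnit A := by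
  have hanti : AntilipschitzWith C.toNNReal A :=
    AddMonoidHomClass.antilipschitz_of_bound A fun x =>
      (hC x).trans (mul_le_mul_of_nonneg_right (Real.le_coe_toNNReal C) (norm_nonneg _))
  have hcl : IsClosed (Set.range A) := hanti.isClosed_range A.uniformContinuous
  have hsurj : Function.Surjective A := by
    rw [← Set.range_eq_univ, ← hcl.closure_eq]
    exact hd.closure_range
  exact ContinuousLinearMap.isUnit_iff_bijective.2 ⟨hanti.injective, hsurj⟩

/-- An eigenvector of `A` or `star A` is one of its square, hence of `B`, which has none. The case
of `star A` is what gives dense ranges. -/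
theorem spectrum_parts_of_sq {A B : H →L[ℂ] H} {k l : ℂ} (hk : k ≠ 0) (hl : l ≠ 0)
    (hA : A * A = k • B) (hA' : star A * star A = l • B)
    (hB : ∀ (c : ℂ) (x : H), B x = c • x → x = 0) :
    pointSpectrum A = ∅ ∧ residualSpectrum A = ∅ ∧ spectrum ℂ A = continuousSpectrum A := by
  have key : ∀ (T : H →L[ℂ] H) (m : ℂ), m ≠ 0 → T * T = m • B →
      ∀ (z : ℂ) (x : H), T x = z • x → x = 0 := by
    intro T m hm hT z x hx
    refine hB (m⁻¹ * z ^ 2) x ?_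
    have h := congrArg (fun S : H →L[ℂ] H => S x) hT
    simp only [mul_apply_eq_comp, hx, map_smul, smul_apply] at h
    rw [mul_smul, pow_two, mul_smul, h, smul_smul, inv_mul_cancel₀ hm, one_smul]
  have hinj : ∀ z : ℂ, Function.Injective fun x : H => z • x - A x := by
    intro z x y hxy
    refine sub_eq_zero.1 (key A k hk hA z (x - y) ?_)
    simp only at hxy
    rw [map_sub, smul_sub, sub_eq_sub_iff_sub_eq_sub]
    rw [← sub_eq_zero] at hxy ⊢
    rw [← neg_eq_zero, ← hxy]; abel
  have hdense : ∀ z : ℂ, DenseRange fun x : H => z • x - A x := by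
    intro z
    -- A vector orthogonal to the range of `z - A` is an eigenvector of `star A` for the conjugate
    -- of `z`.
    have h : (LinearMap.range ((z • (1 : H →L[ℂ] H) - A : H →L[ℂ] H) : H →ₗ[ℂ] H))ᗮ = ⊥ := by
      rw [Submodule.eq_bot_iff]
      intro y hy
      refine key (star A) l hl hA' (starRingEnd ℂ z) y ?_
      refine (sub_eq_zero.1 (ext_inner_left ℂ fun x => ?_)).symm
      have := (Submodule.mem_orthogonal _ _).1 hy _ ⟨x, rfl⟩
      simp only [ContinuousLinearMap.coe_coe, sub_apply,
        smul_apply, one_apply_eq_self, inner_sub_left,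
        inner_smul_left] at this
      rw [inner_zero_right, inner_sub_right, inner_smul_right, ContinuousLinearMap.star_eq_adjoint,
        ContinuousLinearMap.adjoint_inner_right, this]
    rw [← Submodule.topologicalClosure_eq_top_iff] at h
    have h' := Submodule.dense_iff_topologicalClosure_eq_top.2 h
    exact h'
  refine ⟨?_, ?_, ?_⟩
  · exact Set.eq_empty_of_forall_notMem fun z hz => hz.2 (hinj z)
  · exact Set.eq_empty_of_forall_notMem fun z hz => hz.2 (hdense z)
  · refine Set.Subset.antisymm (fun z hz => ⟨hz, hinj z, hdense z, ?_⟩) fun z hz => hz.1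
    rintro ⟨C, hC⟩
    refine hz ?_
    have hfun : ∀ x, (algebraMap ℂ (H →L[ℂ] H) z - A) x = z • x - A x := fun x => by
      simp [Algebra.algebraMap_eq_smul_one]
    refine isUnit_of_denseRange_of_le (C := C) ?_ fun x => by rw [hfun]; exact hC x
    have := hdense z
    rwa [← funext hfun] at this

end Hilbert

/-! ### The Fourier transform of the hyperbolic secant -/

section Sech

/-- The Mellin symbol `1 / (2 cosh (2 π² ν))` of `-i 𝓕_{ℝ⁺}²`, in the frequency variable of
Mathlib's Fourier transform. -/
def sechSymbol (v : ℝ) : ℝ := (2 * Real.cosh (2 * Real.pi ^ 2 * v))⁻¹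

theorem sechSymbol_pos (v : ℝ) : 0 < sechSymbol v := by
  have := Real.cosh_pos (2 * Real.pi ^ 2 * v)
  unfold sechSymbol; positivity

theorem sechSymbol_le (v : ℝ) : sechSymbol v ≤ 1 / 2 := by
  have := Real.one_le_cosh (2 * Real.pi ^ 2 * v)
  unfold sechSymbol
  rw [one_div]
  exact inv_anti₀ (by norm_num) (by linarith)

theorem continuous_sechSymbol : Continuous sechSymbol := by
  unfold sechSymbol
  refine Continuous.inv₀ (by fun_prop) fun v => ?_
  have := Real.cosh_pos (2 * Real.pi ^ 2 * v)
  positivity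

/-- With `y = 4π² v` and `x` its sigmoid, `1 - x = e^{-y} x`, so the left side is `x e^{-y(1-u)}`
for `u = 1/2 + iw/(2π)`. Now `x e^{-y/2} = 1 / (2 cosh (y/2))` is the symbol, and the remaining
factor `e^{y(u-1/2)}` is the character. -/
theorem beta_integrand_sigmoid (w v : ℝ) :
    ((Real.sigmoid (4 * Real.pi ^ 2 * v) : ℝ) : ℂ) ^ ((1 / 2 + Complex.I * w / (2 * Real.pi)) - 1) *
      (1 - ((Real.sigmoid (4 * Real.pi ^ 2 * v) : ℝ) : ℂ)) ^
        ((1 - (1 / 2 + Complex.I * w / (2 * Real.pi))) - 1) *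
      ((Real.sigmoid (4 * Real.pi ^ 2 * v) * (1 - Real.sigmoid (4 * Real.pi ^ 2 * v)) : ℝ) : ℂ) =
    Complex.exp (2 * Real.pi * Complex.I * w * v) * sechSymbol v := by
  set y := 4 * Real.pi ^ 2 * v with hy
  set u : ℂ := 1 / 2 + Complex.I * w / (2 * Real.pi) with hu
  set x := Real.sigmoid y with hx
  have hx0 : 0 < x := Real.sigmoid_pos y
  have hx1 : 1 - x = Real.exp (-y) * x := by
    rw [← Real.sigmoid_neg, ← Real.sigmoid_mul_rexp_neg, mul_comm]
  have hxc : (x : ℂ) ≠ 0 := by exact_mod_cast hx0.ne'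
  have hxe : x * Real.exp (-y / 2) = sechSymbol v := by
    rw [hx, Real.sigmoid_def, sechSymbol, Real.cosh_eq, show 2 * Real.pi ^ 2 * v = y / 2 by
      rw [hy]; ring]
    have h1 : Real.exp (-y) = Real.exp (-y / 2) * Real.exp (-y / 2) := by
      rw [← Real.exp_add]; ring_nf
    have h2 : Real.exp (y / 2) * Real.exp (-y / 2) = 1 := by
      rw [← Real.exp_add]; ring_nf; exact Real.exp_zero
    have h3 := Real.exp_pos (-y / 2)
    have h4 := Real.exp_pos (y / 2)
    rw [show -(y / 2) = -y / 2 by ring, h1]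
    generalize Real.exp (-y / 2) = p at *
    generalize Real.exp (y / 2) = q at *
    field_simp
    linear_combination h2
  have hpow : ∀ (a : ℝ), 0 < a → ∀ z : ℂ, (a : ℂ) ^ z = Complex.exp (Real.log a * z) := by
    intro a ha z
    rw [Complex.cpow_def_of_ne_zero (by exact_mod_cast ha.ne'), Complex.ofReal_log ha.le]
  have e1 : (1 - (x : ℂ)) = ((1 - x : ℝ) : ℂ) := by push_cast; ring
  have hx1' : 0 < 1 - x := by rw [hx1]; positivity
  have hlog : Real.log (1 - x) = Real.log x - y := by
    rw [hx1, Real.log_mul (Real.exp_ne_zero _) hx0.ne', Real.log_exp]; ring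
  rw [e1, hpow _ hx0, hpow _ hx1', ← hxe, hlog]
  have e3 : ((x * (1 - x) : ℝ) : ℂ) = Complex.exp (Real.log x + (Real.log x - y)) := by
    rw [Complex.exp_add, ← Complex.ofReal_sub, ← hlog, ← Complex.ofReal_exp, ← Complex.ofReal_exp,
      Real.exp_log hx0, Real.exp_log hx1', Complex.ofReal_mul]
  have e4 : ((x * Real.exp (-y / 2) : ℝ) : ℂ) = Complex.exp (Real.log x + -y / 2) := by
    rw [Complex.exp_add, ← Complex.ofReal_exp, Real.exp_log hx0]; push_cast; rfl
  rw [e3, e4, ← Complex.exp_add, ← Complex.exp_add, ← Complex.exp_add]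
  congr 1
  have hpi : (Real.pi : ℂ) ≠ 0 := by exact_mod_cast Real.pi_ne_zero
  have hyc : (y : ℂ) = 4 * Real.pi ^ 2 * v := by rw [hy]; push_cast; ring
  rw [hu]
  push_cast
  rw [hyc]
  field_simp
  ring

theorem beta_re_pos (w : ℝ) : 0 < (1 / 2 + Complex.I * w / (2 * Real.pi) : ℂ).re ∧
    0 < (1 - (1 / 2 + Complex.I * w / (2 * Real.pi)) : ℂ).re := by
  have : (Complex.I * w / (2 * Real.pi) : ℂ).re = 0 := by
    have h : (Complex.I * w / (2 * Real.pi) : ℂ) = Complex.I * ((w / (2 * Real.pi) : ℝ) : ℂ) := by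
      push_cast; ring
    rw [h, Complex.I_mul_re, Complex.ofReal_im, neg_zero]
  simp only [Complex.add_re, Complex.sub_re, this]
  norm_num

theorem image_scaled_sigmoid :
    (fun v : ℝ => Real.sigmoid (4 * Real.pi ^ 2 * v)) '' Set.univ = Set.Ioo 0 1 := by
  rw [Set.image_univ, ← Real.range_sigmoid]
  exact (mul_left_surjective₀ (by positivity : (4 * Real.pi ^ 2 : ℝ) ≠ 0)).range_comp
    Real.sigmoid

theorem injective_scaled_sigmoid :
    Function.Injective fun v : ℝ => Real.sigmoid (4 * Real.pi ^ 2 * v) :=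
  Real.sigmoid_injective.comp (mul_right_injective₀ (by positivity : (4 * Real.pi ^ 2 : ℝ) ≠ 0))

theorem hasDerivAt_scaled_sigmoid (v : ℝ) :
    HasDerivAt (fun v : ℝ => Real.sigmoid (4 * Real.pi ^ 2 * v))
      (Real.sigmoid (4 * Real.pi ^ 2 * v) * (1 - Real.sigmoid (4 * Real.pi ^ 2 * v)) *
        (4 * Real.pi ^ 2)) v := by
  have h := (hasDerivAt_id v).const_mul (4 * Real.pi ^ 2)
  rw [mul_one] at h
  exact (Real.hasDerivAt_sigmoid (4 * Real.pi ^ 2 * v)).comp v h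

theorem beta_integrand_sigmoid_smul (w v : ℝ) :
    |Real.sigmoid (4 * Real.pi ^ 2 * v) * (1 - Real.sigmoid (4 * Real.pi ^ 2 * v)) *
        (4 * Real.pi ^ 2)| •
      (((Real.sigmoid (4 * Real.pi ^ 2 * v) : ℝ) : ℂ) ^
          ((1 / 2 + Complex.I * w / (2 * Real.pi)) - 1) *
        (1 - ((Real.sigmoid (4 * Real.pi ^ 2 * v) : ℝ) : ℂ)) ^
          ((1 - (1 / 2 + Complex.I * w / (2 * Real.pi))) - 1)) =
    (4 * Real.pi ^ 2 : ℂ) * (Complex.exp (2 * Real.pi * Complex.I * w * v) * sechSymbol v) := by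
  have h0 := Real.sigmoid_pos (4 * Real.pi ^ 2 * v)
  have h1 := Real.sigmoid_lt_one (4 * Real.pi ^ 2 * v)
  have h2 : 0 < 1 - Real.sigmoid (4 * Real.pi ^ 2 * v) := by linarith
  rw [abs_of_nonneg (by positivity), ← beta_integrand_sigmoid, Complex.real_smul]
  push_cast
  ring

theorem integrable_exp_mul_sechSymbol (w : ℝ) : Integrable fun v : ℝ =>
    Complex.exp (2 * Real.pi * Complex.I * w * v) * sechSymbol v := by
  have h := Complex.betaIntegral_convergent (beta_re_pos w).1 (beta_re_pos w).2
  rw [intervalIntegrable_iff_integrableOn_Ioo_of_le zero_le_one, ← image_scaled_sigmoid,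
    integrableOn_image_iff_integrableOn_abs_deriv_smul MeasurableSet.univ
      (fun v _ => (hasDerivAt_scaled_sigmoid v).hasDerivWithinAt)
      injective_scaled_sigmoid.injOn, integrableOn_univ] at h
  simp only [beta_integrand_sigmoid_smul] at h
  have hpi : (4 * Real.pi ^ 2 : ℂ) ≠ 0 := by
    have : (Real.pi : ℂ) ≠ 0 := by exact_mod_cast Real.pi_ne_zero
    simp [this]
  exact (integrable_const_mul_iff (IsUnit.mk0 _ hpi) _).1 h

theorem integrable_sechSymbol : Integrable sechSymbol := by
  have h := (integrable_exp_mul_sechSymbol 0).re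
  simpa using h

/-- The sigmoid substitution turns the integral into the beta integral `B(u, 1 - u) = π / sin (πu)`
on the line `Re u = 1/2`, where the sine is `cosh (w/2)`. -/
theorem integral_exp_mul_sechSymbol (w : ℝ) :
    ∫ v : ℝ, Complex.exp (2 * Real.pi * Complex.I * w * v) * sechSymbol v =
      ((4 * Real.pi * Real.cosh (w / 2))⁻¹ : ℝ) := by
  have hpi : (Real.pi : ℂ) ≠ 0 := by exact_mod_cast Real.pi_ne_zero
  have h := Complex.betaIntegral_eq_Gamma_mul_div _ _ (beta_re_pos w).1 (beta_re_pos w).2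
  rw [add_sub_cancel, Complex.Gamma_one, div_one, Complex.Gamma_mul_Gamma_one_sub,
    Complex.betaIntegral, intervalIntegral.integral_of_le zero_le_one,
    integral_Ioc_eq_integral_Ioo, ← image_scaled_sigmoid,
    integral_image_eq_integral_abs_deriv_smul MeasurableSet.univ
      (fun v _ => (hasDerivAt_scaled_sigmoid v).hasDerivWithinAt)
      injective_scaled_sigmoid.injOn, setIntegral_univ] at h
  simp only [beta_integrand_sigmoid_smul] at h
  rw [integral_const_mul] at h
  have hs : Complex.sin (Real.pi * (1 / 2 + Complex.I * w / (2 * Real.pi))) =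
      Real.cosh (w / 2) := by
    have : (Real.pi * (1 / 2 + Complex.I * w / (2 * Real.pi)) : ℂ) =
        (w / 2 : ℂ) * Complex.I + Real.pi / 2 := by field_simp; ring
    rw [this, Complex.sin_add_pi_div_two, Complex.cos_mul_I]
    push_cast; rfl
  rw [hs] at h
  have hc : (Real.cosh (w / 2) : ℂ) ≠ 0 := by exact_mod_cast (Real.cosh_pos _).ne'
  rw [Complex.ofReal_inv, Complex.ofReal_mul]
  refine mul_left_cancel₀ (mul_ne_zero (by norm_num) (pow_ne_zero 2 hpi) :
    (4 * Real.pi ^ 2 : ℂ) ≠ 0) (h.trans ?_)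
  push_cast at hc ⊢
  field_simp

end Sech

/-! ### Two half-line Fourier integrals make a Stieltjes transform -/

section Stieltjes

open Filter Topology Set

theorem norm_cexp_I_mul_mul (t u : ℝ) : ‖Complex.exp (Complex.I * t * u)‖ = 1 := by
  rw [show (Complex.I * t * u : ℂ) = ((t * u : ℝ) : ℂ) * Complex.I by push_cast; ring,
    Complex.norm_exp_ofReal_mul_I]

theorem integral_exp_damped {ε : ℝ} (hε : 0 < ε) (a : ℝ) :
    ∫ u in Ioi (0 : ℝ), Complex.exp (-ε * u) * Complex.exp (Complex.I * a * u) =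
      (ε - Complex.I * a : ℂ)⁻¹ := by
  have hre : (-(ε - Complex.I * a) : ℂ).re < 0 := by simpa using hε
  have h := integral_exp_mul_complex_Ioi hre 0
  simp only [Complex.ofReal_zero, mul_zero, Complex.exp_zero] at h
  rw [neg_div_neg_eq, one_div] at h
  rw [← h]
  refine integral_congr_ae (Eventually.of_forall fun u => ?_)
  simp only [← Complex.exp_add]
  ring_nf

/-- The factor `e^{-εu}` makes the double integral absolutely convergent, so that Fubini applies. -/
theorem integral_damped_fourier {f : ℝ → ℂ} (hf : IntegrableOn f (Ioi 0)) {ε : ℝ} (hε : 0 < ε)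
    (s : ℝ) :
    ∫ u in Ioi (0 : ℝ), Complex.exp (-ε * u) *
        ((∫ v in Ioi (0 : ℝ), f v * Complex.exp (Complex.I * u * v)) *
          Complex.exp (Complex.I * s * u)) =
      ∫ v in Ioi (0 : ℝ), f v * (ε - Complex.I * ((s + v : ℝ) : ℂ))⁻¹ := by
  have hexp : IntegrableOn (fun u : ℝ => Complex.exp (-ε * u)) (Ioi 0) := by
    have := integrableOn_exp_mul_complex_Ioi (a := (-ε : ℂ)) (by simpa using hε) 0
    exact this
  have hprod : Integrable (Function.uncurry fun u v : ℝ => Complex.exp (-ε * u) * f v *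
      Complex.exp (Complex.I * ((s + v : ℝ) : ℂ) * u))
      ((volume.restrict (Ioi 0)).prod (volume.restrict (Ioi 0))) := by
    refine (hexp.mul_prod hf).mul_bdd (c := 1) ?_ (Eventually.of_forall fun p => ?_)
    · exact (by fun_prop : Continuous fun p : ℝ × ℝ =>
        Complex.exp (Complex.I * ((s + p.2 : ℝ) : ℂ) * p.1)).aestronglyMeasurable
    · exact (norm_cexp_I_mul_mul (s + p.2) p.1).le
  calc _ = ∫ u in Ioi (0 : ℝ), ∫ v in Ioi (0 : ℝ), Complex.exp (-ε * u) * f v *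
      Complex.exp (Complex.I * ((s + v : ℝ) : ℂ) * u) := by
        refine integral_congr_ae (Eventually.of_forall fun u => ?_)
        simp only
        rw [← integral_mul_const, ← integral_const_mul]
        refine integral_congr_ae (Eventually.of_forall fun v => ?_)
        simp only
        rw [show (Complex.I * ((s + v : ℝ) : ℂ) * u : ℂ) =
          Complex.I * u * v + Complex.I * s * u by push_cast; ring, Complex.exp_add]
        ring
    _ = ∫ v in Ioi (0 : ℝ), ∫ u in Ioi (0 : ℝ), Complex.exp (-ε * u) * f v *
      Complex.exp (Complex.I * ((s + v : ℝ) : ℂ) * u) := integral_integral_swap hprod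
    _ = _ := by
        refine integral_congr_ae (Eventually.of_forall fun v => ?_)
        simp only
        rw [← integral_exp_damped hε, ← integral_const_mul]
        refine integral_congr_ae (Eventually.of_forall fun u => ?_)
        simp only
        ring

/-- Abel summation: both sides of `integral_damped_fourier` converge as `ε → 0⁺`. The left is
dominated by the inner transform. The right is dominated because `|ε - i(s + v)| ≥ s`, where
positivity of `s` and `v` matters. -/
theorem integral_fourier_fourier {f : ℝ → ℂ} (hf : IntegrableOn f (Ioi 0))
    (hG : IntegrableOn
      (fun u : ℝ => ∫ v in Ioi (0 : ℝ), f v * Complex.exp (Complex.I * u * v)) (Ioi 0))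
    {s : ℝ} (hs : 0 < s) :
    ∫ u in Ioi (0 : ℝ), (∫ v in Ioi (0 : ℝ), f v * Complex.exp (Complex.I * u * v)) *
        Complex.exp (Complex.I * s * u) =
      Complex.I * ∫ v in Ioi (0 : ℝ), f v * ((s + v : ℝ) : ℂ)⁻¹ := by
  set G : ℝ → ℂ := fun u => ∫ v in Ioi (0 : ℝ), f v * Complex.exp (Complex.I * u * v) with hGdef
  have hl : Tendsto (fun ε : ℝ => ∫ u in Ioi (0 : ℝ), Complex.exp (-ε * u) *
      (G u * Complex.exp (Complex.I * s * u))) (𝓝[>] 0)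
      (𝓝 (∫ u in Ioi (0 : ℝ), G u * Complex.exp (Complex.I * s * u))) := by
    refine tendsto_integral_filter_of_dominated_convergence (fun u => ‖G u‖)
      (Eventually.of_forall fun ε => ?_) ?_ hG.norm ?_
    · exact (by fun_prop : Continuous fun u : ℝ => Complex.exp (-ε * u)).aestronglyMeasurable.mul
        (hG.aestronglyMeasurable.mul (by fun_prop :
          Continuous fun u : ℝ => Complex.exp (Complex.I * s * u)).aestronglyMeasurable)
    · filter_upwards [self_mem_nhdsWithin] with ε hε
      filter_upwards [ae_restrict_mem measurableSet_Ioi] with u hu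
      rw [norm_mul, norm_mul, norm_cexp_I_mul_mul, mul_one]
      refine mul_le_of_le_one_left (norm_nonneg _) ?_
      rw [Complex.norm_exp, show (-ε * u : ℂ) = ((-ε * u : ℝ) : ℂ) by push_cast; ring,
        Complex.ofReal_re, Real.exp_le_one_iff]
      nlinarith [mem_Ioi.1 hε, mem_Ioi.1 hu]
    · refine Eventually.of_forall fun u => ?_
      have : Continuous fun ε : ℝ => Complex.exp (-ε * u) *
          (G u * Complex.exp (Complex.I * s * u)) := by fun_prop
      have h := this.tendsto 0
      simp only [Complex.ofReal_zero, neg_zero, zero_mul, Complex.exp_zero, one_mul] at h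
      exact h.mono_left nhdsWithin_le_nhds
  have hr : Tendsto (fun ε : ℝ => ∫ v in Ioi (0 : ℝ),
      f v * (ε - Complex.I * ((s + v : ℝ) : ℂ))⁻¹) (𝓝[>] 0)
      (𝓝 (∫ v in Ioi (0 : ℝ), f v * (0 - Complex.I * ((s + v : ℝ) : ℂ))⁻¹)) := by
    have hne : ∀ v : ℝ, 0 < v → ∀ ε : ℝ, s ≤ ‖(ε - Complex.I * ((s + v : ℝ) : ℂ) : ℂ)‖ := by
      intro v hv ε
      have h1 := Complex.abs_im_le_norm (ε - Complex.I * ((s + v : ℝ) : ℂ) : ℂ)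
      have h2 : (ε - Complex.I * ((s + v : ℝ) : ℂ) : ℂ).im = -(s + v) := by simp
      rw [h2, abs_neg, abs_of_pos (by linarith)] at h1
      linarith
    refine tendsto_integral_filter_of_dominated_convergence (fun v => ‖f v‖ * s⁻¹)
      ?_ ?_ (hf.norm.mul_const _) ?_
    · refine Eventually.of_forall fun ε => hf.aestronglyMeasurable.mul ?_
      exact (by fun_prop : Measurable fun v : ℝ =>
        (ε - Complex.I * ((s + v : ℝ) : ℂ))⁻¹).aestronglyMeasurable
    · refine Eventually.of_forall fun ε => ?_
      filter_upwards [ae_restrict_mem measurableSet_Ioi] with v hv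
      rw [norm_mul, norm_inv]
      exact mul_le_mul_of_nonneg_left (inv_anti₀ hs (hne v hv ε)) (norm_nonneg _)
    · filter_upwards [ae_restrict_mem measurableSet_Ioi] with v hv
      have h0 := hne v hv 0
      have : ContinuousAt (fun ε : ℝ => f v * (ε - Complex.I * ((s + v : ℝ) : ℂ))⁻¹) 0 := by
        refine continuousAt_const.mul (ContinuousAt.inv₀ (by fun_prop) ?_)
        exact norm_pos_iff.1 (hs.trans_le h0)
      have h := this.tendsto
      simp only [Complex.ofReal_zero] at h
      exact h.mono_left nhdsWithin_le_nhds
  have heq : ∀ᶠ ε : ℝ in 𝓝[>] 0, _ = _ :=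
    eventually_nhdsWithin_of_forall fun ε (hε : ε ∈ Ioi (0 : ℝ)) => integral_damped_fourier hf hε s
  rw [tendsto_nhds_unique (hl.congr' heq) hr, ← integral_const_mul]
  refine integral_congr_ae (Eventually.of_forall fun v => ?_)
  simp only
  rw [zero_sub, ← neg_mul, mul_inv, inv_neg, Complex.inv_I]
  ring

end Stieltjes

/-! ### Test functions on the half-line -/

section TestFunctions

/-- Smooth real functions with compact support inside `ℝ⁺`. -/
structure IsTestPos (g : ℝ → ℝ) : Prop where
  contDiff : ContDiff ℝ ∞ g
  hasCompactSupport : HasCompactSupport g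
  tsupport_subset : tsupport g ⊆ Set.Ioi 0

namespace IsTestPos

variable {g : ℝ → ℝ} (hg : IsTestPos g)

include hg

theorem eq_zero {t : ℝ} (ht : t ≤ 0) : g t = 0 :=
  image_eq_zero_of_notMem_tsupport fun h => absurd (hg.tsupport_subset h) (not_lt.2 ht)

theorem continuous_ofReal : Continuous fun t => (g t : ℂ) :=
  Complex.continuous_ofReal.comp hg.contDiff.continuous

theorem hasCompactSupport_ofReal : HasCompactSupport fun t => (g t : ℂ) :=
  hg.hasCompactSupport.comp_left (g := fun t : ℝ => (t : ℂ)) Complex.ofReal_zero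

theorem contDiff_ofReal : ContDiff ℝ ∞ fun t => (g t : ℂ) :=
  Complex.ofRealCLM.contDiff.comp hg.contDiff

theorem memLp_ofReal (p : ENNReal) (μ : Measure ℝ) [IsFiniteMeasureOnCompacts μ] :
    MemLp (fun t => (g t : ℂ)) p μ :=
  hg.continuous_ofReal.memLp_of_hasCompactSupport hg.hasCompactSupport_ofReal

theorem integrable_ofReal (μ : Measure ℝ) [IsFiniteMeasureOnCompacts μ] :
    Integrable (fun t => (g t : ℂ)) μ :=
  memLp_one_iff_integrable.1 (hg.memLp_ofReal 1 μ)

/-- A test function as an element of `L²(ℝ⁺)`. -/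
def toL2Pos : L2Pos := (hg.memLp_ofReal 2 _).toLp _

theorem coeFn_toL2Pos : hg.toL2Pos =ᵐ[volume.restrict (Set.Ioi 0)] fun t => (g t : ℂ) :=
  MemLp.coeFn_toLp _

/-- The function is a dilate of the inverse transform of a Schwartz function. Integrability is what
allows the integral formula for `truncatedFourier` to be used a second time. -/
theorem integrable_integral : Integrable fun u : ℝ =>
    ∫ v in Set.Ioi (0 : ℝ), (g v : ℂ) * Complex.exp (Complex.I * u * v) := by
  have h := ((𝓕⁻ (hg.hasCompactSupport_ofReal.toSchwartzMap hg.contDiff_ofReal)).integrable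
    (μ := volume)).comp_mul_left' (R := (2 * Real.pi)⁻¹) (by positivity)
  refine h.congr (Filter.Eventually.of_forall fun u => ?_)
  simp only [SchwartzMap.fourierInv_coe]
  rw [Real.fourierInv_eq', ← integral_indicator measurableSet_Ioi]
  refine integral_congr_ae (Filter.Eventually.of_forall fun v => ?_)
  by_cases hv : v ∈ Set.Ioi (0 : ℝ)
  · simp only [Set.indicator_of_mem hv, smul_eq_mul]
    rw [mul_comm]
    congr 2
    have : (Real.pi : ℂ) ≠ 0 := by exact_mod_cast Real.pi_ne_zero
    simp only [RCLike.inner_apply, conj_trivial]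
    push_cast
    field_simp
  · simp only [Set.indicator_of_notMem hv]
    change _ • (g v : ℂ) = 0
    rw [hg.eq_zero (not_lt.1 hv), Complex.ofReal_zero, smul_zero]

theorem truncatedFourier_toL2Pos :
    truncatedFourier hg.toL2Pos =ᵐ[volume.restrict (Set.Ioi 0)] fun t : ℝ =>
      ((Real.sqrt (2 * Real.pi))⁻¹ : ℂ) *
        ∫ v in Set.Ioi (0 : ℝ), (g v : ℂ) * Complex.exp (Complex.I * t * v) := by
  refine (truncatedFourier_ae hg.toL2Pos
    ((hg.integrable_ofReal _).congr hg.coeFn_toL2Pos.symm)).trans ?_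
  refine Filter.Eventually.of_forall fun t => ?_
  simp only
  congr 1
  refine integral_congr_ae ?_
  filter_upwards [hg.coeFn_toL2Pos] with v hv
  rw [hv]

theorem truncatedFourier_truncatedFourier_toL2Pos :
    truncatedFourier (truncatedFourier hg.toL2Pos) =ᵐ[volume.restrict (Set.Ioi 0)]
      fun s : ℝ => Complex.I * ((2 * Real.pi : ℝ) : ℂ)⁻¹ *
        ∫ v in Set.Ioi (0 : ℝ), (g v : ℂ) * ((s + v : ℝ) : ℂ)⁻¹ := by
  have h1 := hg.truncatedFourier_toL2Pos
  have hint : Integrable (truncatedFourier hg.toL2Pos) (volume.restrict (Set.Ioi 0)) :=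
    (hg.integrable_integral.restrict.const_mul _).congr h1.symm
  filter_upwards [truncatedFourier_ae _ hint, ae_restrict_mem measurableSet_Ioi] with s hs hs0
  rw [hs]
  have h2 : ∫ u in Set.Ioi (0 : ℝ), truncatedFourier hg.toL2Pos u *
      Complex.exp (Complex.I * s * u) = ((Real.sqrt (2 * Real.pi))⁻¹ : ℂ) *
      ∫ u in Set.Ioi (0 : ℝ), (∫ v in Set.Ioi (0 : ℝ), (g v : ℂ) *
        Complex.exp (Complex.I * u * v)) * Complex.exp (Complex.I * s * u) := by
    rw [← integral_const_mul]
    refine integral_congr_ae ?_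
    filter_upwards [h1] with u hu
    rw [hu, mul_assoc]
  rw [h2, integral_fourier_fourier (hg.integrable_ofReal _) hg.integrable_integral.restrict hs0]
  have h3 : ((Real.sqrt (2 * Real.pi) : ℝ) : ℂ) * (Real.sqrt (2 * Real.pi) : ℝ) =
      ((2 * Real.pi : ℝ) : ℂ) := by
    rw [← Complex.ofReal_mul, Real.mul_self_sqrt (by positivity)]
  rw [← h3, mul_inv]
  ring

end IsTestPos

theorem eq_zero_of_inner_isTestPos {x : L2Pos}
    (h : ∀ (g : ℝ → ℝ) (hg : IsTestPos g), inner ℂ hg.toL2Pos x = 0) : x = 0 := by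
  have hloc : LocallyIntegrableOn x (Set.Ioi (0 : ℝ)) volume :=
    locallyIntegrableOn_of_locallyIntegrable_restrict ((Lp.memLp x).locallyIntegrable (by norm_num))
  have := isOpen_Ioi.ae_eq_zero_of_integral_contDiff_smul_eq_zero hloc fun g h1 h2 h3 => by
    have h4 := h g ⟨h1, h2, h3⟩
    rw [L2.inner_def] at h4
    rw [← setIntegral_eq_integral_of_forall_compl_eq_zero (s := Set.Ioi 0), ← h4]
    · refine integral_congr_ae ?_
      filter_upwards [(IsTestPos.mk h1 h2 h3).coeFn_toL2Pos] with t ht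
      rw [ht]
      simp [mul_comm]
    · intro t ht
      rw [IsTestPos.eq_zero ⟨h1, h2, h3⟩ (not_lt.1 ht), zero_smul]
  refine (Lp.eq_zero_iff_ae_eq_zero).2 ((ae_restrict_iff' measurableSet_Ioi).2 this)

end TestFunctions

/-! ### Logarithmic variable and Mellin transform -/

section LogChange

theorem lintegral_Ioi_eq_lintegral_exp (f : ℝ → ENNReal) :
    ∫⁻ t in Set.Ioi (0 : ℝ), f t = ∫⁻ u : ℝ, ENNReal.ofReal (Real.exp u) * f (Real.exp u) := by
  have h := lintegral_image_eq_lintegral_abs_deriv_mul MeasurableSet.univ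
    (fun u _ => (Real.hasDerivAt_exp u).hasDerivWithinAt) Real.exp_injective.injOn f
  rw [Set.image_univ, Real.range_exp, Measure.restrict_univ] at h
  simpa only [abs_of_pos (Real.exp_pos _)] using h

theorem integral_Ioi_eq_integral_exp (f : ℝ → ℂ) :
    ∫ t in Set.Ioi (0 : ℝ), f t = ∫ u : ℝ, (Real.exp u : ℂ) * f (Real.exp u) := by
  have h := integral_image_eq_integral_abs_deriv_smul MeasurableSet.univ
    (fun u _ => (Real.hasDerivAt_exp u).hasDerivWithinAt) Real.exp_injective.injOn f
  rw [Set.image_univ, Real.range_exp, Measure.restrict_univ] at h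
  simpa only [abs_of_pos (Real.exp_pos _), Complex.real_smul] using h

theorem quasiMeasurePreserving_log :
    Measure.QuasiMeasurePreserving Real.log (volume.restrict (Set.Ioi 0)) volume := by
  refine ⟨Real.measurable_log, Measure.AbsolutelyContinuous.mk fun s hs h0 => ?_⟩
  rw [Measure.map_apply Real.measurable_log hs, ← lintegral_indicator_one
    (Real.measurable_log hs), lintegral_Ioi_eq_lintegral_exp]
  have : ∀ u : ℝ, ENNReal.ofReal (Real.exp u) *
      (Real.log ⁻¹' s).indicator 1 (Real.exp u) =
      s.indicator (fun u => ENNReal.ofReal (Real.exp u)) u := by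
    intro u
    by_cases hu : u ∈ s
    · have : Real.exp u ∈ Real.log ⁻¹' s := by simpa using hu
      simp [hu, this]
    · have : Real.exp u ∉ Real.log ⁻¹' s := by simpa using hu
      simp [hu, this]
  simp_rw [this]
  rw [lintegral_indicator hs]
  exact setLIntegral_measure_zero s _ h0

/-- Under `t = e^u` the Jacobian `e^u` cancels the square of the weight `t^{-1/2}`. -/
theorem eLpNorm_logChange (f : L2Real) :
    eLpNorm (fun t : ℝ => ((Real.sqrt t)⁻¹ : ℂ) * f (Real.log t)) 2 (volume.restrict (Set.Ioi 0)) =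
      eLpNorm f 2 volume := by
  rw [eLpNorm_eq_lintegral_rpow_enorm_toReal two_ne_zero ENNReal.ofNat_ne_top,
    eLpNorm_eq_lintegral_rpow_enorm_toReal two_ne_zero ENNReal.ofNat_ne_top,
    lintegral_Ioi_eq_lintegral_exp]
  congr 1
  refine lintegral_congr fun u => ?_
  have h : ‖((Real.sqrt (Real.exp u))⁻¹ : ℂ)‖ₑ ^ (2 : ENNReal).toReal =
      (ENNReal.ofReal (Real.exp u))⁻¹ := by
    rw [← ofReal_norm, norm_inv, Complex.norm_real, Real.norm_eq_abs,
      abs_of_nonneg (Real.sqrt_nonneg _), ENNReal.ofReal_rpow_of_nonneg (by positivity) (by simp),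
      ENNReal.toReal_ofNat, Real.rpow_two, inv_pow, Real.sq_sqrt (Real.exp_pos _).le,
      ENNReal.ofReal_inv_of_pos (Real.exp_pos _)]
  rw [Real.log_exp, enorm_mul, ENNReal.mul_rpow_of_nonneg _ _ (by simp), h, ← mul_assoc,
    ENNReal.mul_inv_cancel (by simpa using Real.exp_pos u) ENNReal.ofReal_ne_top, one_mul]

theorem memLp_logChange (f : L2Real) :
    MemLp (fun t : ℝ => ((Real.sqrt t)⁻¹ : ℂ) * f (Real.log t)) 2
      (volume.restrict (Set.Ioi 0)) := by
  refine ⟨?_, ?_⟩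
  · refine AEStronglyMeasurable.mul (by fun_prop : Measurable fun t : ℝ =>
      ((Real.sqrt t)⁻¹ : ℂ)).aestronglyMeasurable ?_
    exact (Lp.aestronglyMeasurable f).comp_quasiMeasurePreserving quasiMeasurePreserving_log
  · rw [eLpNorm_logChange]
    exact Lp.eLpNorm_lt_top f

/-- The isometry `f ↦ (t ↦ t^{-1/2} f(log t))` from `L²(ℝ)` to `L²(ℝ⁺)`. -/
def logChange : L2Real →ₗᵢ[ℂ] L2Pos where
  toFun f := (memLp_logChange f).toLp _
  map_add' f g := by
    rw [← MemLp.toLp_add]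
    apply MemLp.toLp_congr
    filter_upwards [quasiMeasurePreserving_log.ae (Lp.coeFn_add f g)] with t ht
    simp only [ht, Pi.add_apply, mul_add]
  map_smul' c f := by
    rw [RingHom.id_apply, ← MemLp.toLp_const_smul]
    apply MemLp.toLp_congr
    filter_upwards [quasiMeasurePreserving_log.ae (Lp.coeFn_smul c f)] with t ht
    simp only [ht, Pi.smul_apply, smul_eq_mul]
    ring
  norm_map' f := by
    change ‖(memLp_logChange f).toLp _‖ = ‖f‖
    rw [Lp.norm_toLp, eLpNorm_logChange, Lp.norm_def]

namespace IsTestPos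

variable {g : ℝ → ℝ} (hg : IsTestPos g)

include hg

theorem hasCompactSupport_exp_comp :
    HasCompactSupport fun u : ℝ => ((Real.sqrt (Real.exp u) * g (Real.exp u) : ℝ) : ℂ) := by
  have hK : IsCompact (Real.log '' tsupport g) :=
    hg.hasCompactSupport.image_of_continuousOn (Real.continuousOn_log.mono fun t ht =>
      (hg.tsupport_subset ht).ne')
  refine HasCompactSupport.intro hK fun u hu => ?_
  have : Real.exp u ∉ tsupport g := fun h => hu ⟨_, h, Real.log_exp u⟩
  rw [image_eq_zero_of_notMem_tsupport this, mul_zero, Complex.ofReal_zero]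

theorem continuous_exp_comp :
    Continuous fun u : ℝ => ((Real.sqrt (Real.exp u) * g (Real.exp u) : ℝ) : ℂ) := by
  have := hg.contDiff.continuous
  fun_prop

theorem memLp_exp_comp (p : ENNReal) :
    MemLp (fun u : ℝ => ((Real.sqrt (Real.exp u) * g (Real.exp u) : ℝ) : ℂ)) p volume :=
  hg.continuous_exp_comp.memLp_of_hasCompactSupport hg.hasCompactSupport_exp_comp

theorem integrable_exp_comp :
    Integrable fun u : ℝ => ((Real.sqrt (Real.exp u) * g (Real.exp u) : ℝ) : ℂ) :=
  memLp_one_iff_integrable.1 (hg.memLp_exp_comp 1)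

/-- The preimage of a test function under `logChange`. -/
def toL2Real : L2Real := (hg.memLp_exp_comp 2).toLp _

theorem coeFn_toL2Real :
    hg.toL2Real =ᵐ[volume] fun u : ℝ => ((Real.sqrt (Real.exp u) * g (Real.exp u) : ℝ) : ℂ) :=
  MemLp.coeFn_toLp _

theorem logChange_toL2Real : logChange hg.toL2Real = hg.toL2Pos := by
  refine MemLp.toLp_congr (memLp_logChange _) (hg.memLp_ofReal 2 _) ?_
  filter_upwards [quasiMeasurePreserving_log.ae hg.coeFn_toL2Real,
    ae_restrict_mem measurableSet_Ioi] with t ht ht0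
  have h0 : ((Real.sqrt t : ℝ) : ℂ) ≠ 0 := by
    exact_mod_cast (Real.sqrt_pos.2 ht0).ne'
  rw [ht, Real.exp_log ht0, Complex.ofReal_mul, ← mul_assoc, inv_mul_cancel₀ h0, one_mul]

end IsTestPos

theorem dense_span_isTestPos :
    Dense (Submodule.span ℂ {x : L2Pos | ∃ (g : ℝ → ℝ) (hg : IsTestPos g), x = hg.toL2Pos} :
      Set L2Pos) := by
  rw [Submodule.dense_iff_topologicalClosure_eq_top, Submodule.topologicalClosure_eq_top_iff,
    Submodule.eq_bot_iff]
  intro x hx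
  exact eq_zero_of_inner_isTestPos fun g hg =>
    (Submodule.mem_orthogonal _ _).1 hx _ (Submodule.subset_span ⟨g, hg, rfl⟩)

/-- The range of an isometry is closed, and it contains the test functions, whose span is dense. -/
theorem surjective_logChange : Function.Surjective logChange := by
  have hcl : IsClosed (LinearMap.range logChange.toLinearMap : Set L2Pos) :=
    logChange.isometry.isClosedEmbedding.isClosed_range
  have hsub : (Submodule.span ℂ {x : L2Pos | ∃ (g : ℝ → ℝ) (hg : IsTestPos g), x = hg.toL2Pos}) ≤
      LinearMap.range logChange.toLinearMap := by
    rw [Submodule.span_le]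
    rintro _ ⟨g, hg, rfl⟩
    exact ⟨_, hg.logChange_toL2Real⟩
  intro x
  exact hcl.closure_subset_iff.2 hsub (dense_span_isTestPos x)

/-- `logChange` as a unitary operator. -/
def logChangeEquiv : L2Real ≃ₗᵢ[ℂ] L2Pos :=
  LinearIsometryEquiv.ofSurjective logChange surjective_logChange

/-- The Mellin transform `L²(ℝ⁺) → L²(ℝ)`. -/
def mellinL2 : L2Pos ≃ₗᵢ[ℂ] L2Real :=
  logChangeEquiv.symm.trans (Lp.fourierTransformₗᵢ ℝ ℂ).symm

namespace IsTestPos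

variable {g : ℝ → ℝ} (hg : IsTestPos g)

include hg

theorem mellinL2_toL2Pos : mellinL2 hg.toL2Pos =ᵐ[volume] fun v : ℝ =>
    ∫ u : ℝ, Complex.exp (2 * Real.pi * Complex.I * u * v) *
      ((Real.sqrt (Real.exp u) * g (Real.exp u) : ℝ) : ℂ) := by
  have h1 : logChangeEquiv.symm hg.toL2Pos = hg.toL2Real := by
    rw [LinearIsometryEquiv.symm_apply_eq]
    exact hg.logChange_toL2Real.symm
  have h2 : mellinL2 hg.toL2Pos = (𝓕⁻ hg.toL2Real : L2Real) := by
    rw [← h1]; rfl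
  rw [h2]
  refine (fourierInv_ae hg.toL2Real (hg.integrable_exp_comp.congr hg.coeFn_toL2Real.symm)).trans ?_
  refine Filter.Eventually.of_forall fun v => ?_
  simp only
  rw [Real.fourierInv_eq']
  refine integral_congr_ae ?_
  filter_upwards [hg.coeFn_toL2Real] with u hu
  rw [hu, smul_eq_mul]
  congr 2
  simp only [RCLike.inner_apply, conj_trivial]
  push_cast
  ring

end IsTestPos

end LogChange

/-! ### Diagonalisation of the Carleman operator -/

section MellinModel

open Filter

theorem norm_cexp_two_pi (w v : ℝ) : ‖Complex.exp (2 * Real.pi * Complex.I * w * v)‖ = 1 := by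
  rw [show (2 * Real.pi * Complex.I * w * v : ℂ) = ((2 * Real.pi * w * v : ℝ) : ℂ) * Complex.I by
    push_cast; ring, Complex.norm_exp_ofReal_mul_I]

theorem memLp_top_sechSymbol : MemLp (fun v => (sechSymbol v : ℂ)) ⊤ volume :=
  memLp_top_of_bound (Complex.continuous_ofReal.comp continuous_sechSymbol).aestronglyMeasurable
    (1 / 2) (Eventually.of_forall fun v => by
      rw [Complex.norm_real, Real.norm_eq_abs, abs_of_pos (sechSymbol_pos v)]
      exact sechSymbol_le v)

/-- Multiplication by `sechSymbol` on `L²(ℝ)`. -/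
def mulSech : L2Real →L[ℂ] L2Real :=
  (ContinuousLinearMap.mul ℂ ℂ).holderL volume ⊤ 2 2 (memLp_top_sechSymbol.toLp _)

theorem coeFn_mulSech (f : L2Real) : mulSech f =ᵐ[volume] fun v => (sechSymbol v : ℂ) * f v := by
  filter_upwards [(ContinuousLinearMap.mul ℂ ℂ).coeFn_holder (r := 2)
    (memLp_top_sechSymbol.toLp _) f, memLp_top_sechSymbol.coeFn_toLp] with v h1 h2
  rw [← h2]
  exact h1

/-- Multiplication by the symbol corresponds to convolution with its Fourier transform. In the form
of a sesquilinear identity this is just Fubini, as the symbol, `φ` and `γ` are all integrable. -/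
theorem fourier_form_sechSymbol {φ γ : ℝ → ℂ} (hφ : Integrable φ) (hγ : Integrable γ)
    (hφr : ∀ u, starRingEnd ℂ (φ u) = φ u) :
    ∫ v : ℝ, (sechSymbol v : ℂ) * (∫ u : ℝ, Complex.exp (2 * Real.pi * Complex.I * u * v) * γ u) *
        starRingEnd ℂ (∫ u : ℝ, Complex.exp (2 * Real.pi * Complex.I * u * v) * φ u) =
      ∫ u : ℝ, φ u * ∫ w : ℝ, γ w * ((4 * Real.pi * Real.cosh ((w - u) / 2))⁻¹ : ℝ) := by
  have hF : Integrable (Function.uncurry fun (v : ℝ) (p : ℝ × ℝ) => (sechSymbol v : ℂ) *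
      (φ p.1 * γ p.2) * Complex.exp (2 * Real.pi * Complex.I * ((p.2 - p.1 : ℝ) : ℂ) * v))
      (volume.prod (volume.prod volume)) := by
    refine (integrable_sechSymbol.ofReal.mul_prod (hφ.mul_prod hγ)).mul_bdd (c := 1) ?_
      (Eventually.of_forall fun p => ?_)
    · exact (by fun_prop : Continuous fun p : ℝ × ℝ × ℝ => Complex.exp (2 * Real.pi * Complex.I *
        ((p.2.2 - p.2.1 : ℝ) : ℂ) * p.1)).aestronglyMeasurable
    · exact (norm_cexp_two_pi _ _).le
  have hK : ∀ p : ℝ × ℝ, ∫ v : ℝ, (sechSymbol v : ℂ) * (φ p.1 * γ p.2) *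
      Complex.exp (2 * Real.pi * Complex.I * ((p.2 - p.1 : ℝ) : ℂ) * v) =
      φ p.1 * (γ p.2 * ((4 * Real.pi * Real.cosh ((p.2 - p.1) / 2))⁻¹ : ℝ)) := by
    intro p
    rw [← integral_exp_mul_sechSymbol, ← mul_assoc, ← integral_const_mul]
    refine integral_congr_ae (Eventually.of_forall fun v => ?_)
    simp only
    ring
  have hint : Integrable (fun p : ℝ × ℝ =>
      φ p.1 * (γ p.2 * ((4 * Real.pi * Real.cosh ((p.2 - p.1) / 2))⁻¹ : ℝ)))
      (volume.prod volume) := by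
    have := hF.integral_prod_right
    simp only [Function.uncurry_apply_pair, hK] at this
    exact this
  calc _ = ∫ v : ℝ, ∫ p : ℝ × ℝ, (sechSymbol v : ℂ) * (φ p.1 * γ p.2) *
      Complex.exp (2 * Real.pi * Complex.I * ((p.2 - p.1 : ℝ) : ℂ) * v) := by
        refine integral_congr_ae (Eventually.of_forall fun v => ?_)
        simp only
        rw [← integral_conj, mul_assoc, mul_comm (∫ u : ℝ, _), ← integral_prod_mul,
          ← integral_const_mul]
        refine integral_congr_ae (Eventually.of_forall fun p => ?_)
        simp only
        rw [map_mul, hφr, ← Complex.exp_conj]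
        simp only [map_mul, Complex.conj_ofReal, Complex.conj_I, map_ofNat]
        rw [show (2 * Real.pi * Complex.I * ((p.2 - p.1 : ℝ) : ℂ) * v : ℂ) =
          2 * Real.pi * -Complex.I * p.1 * v + 2 * Real.pi * Complex.I * p.2 * v by
            push_cast; ring, Complex.exp_add]
        ring
    _ = ∫ p : ℝ × ℝ, ∫ v : ℝ, (sechSymbol v : ℂ) * (φ p.1 * γ p.2) *
      Complex.exp (2 * Real.pi * Complex.I * ((p.2 - p.1 : ℝ) : ℂ) * v) :=
        integral_integral_swap hF
    _ = _ := by
        simp only [hK]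
        rw [Measure.volume_eq_prod, integral_prod _ hint]
        refine integral_congr_ae (Eventually.of_forall fun u => ?_)
        simp only
        rw [integral_const_mul]

/-- The positive operator `-i 𝓕_{ℝ⁺}²`, which is `(2π)⁻¹` times the Carleman operator with kernel
`1 / (s + t)`. -/
def carleman : L2Pos →L[ℂ] L2Pos := (-Complex.I) • (truncatedFourier * truncatedFourier)

/-- The Carleman kernel in logarithmic variables, with both Jacobians: `e^u + e^w = 2 e^{(u+w)/2}
cosh ((w-u)/2)` leaves a function of `w - u` and the weights of `logChange`. -/
theorem exp_mul_exp_div (u w : ℝ) :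
    Real.exp u * Real.exp w * (2 * Real.pi)⁻¹ * (Real.exp u + Real.exp w)⁻¹ =
      Real.sqrt (Real.exp u) * Real.sqrt (Real.exp w) *
        (4 * Real.pi * Real.cosh ((w - u) / 2))⁻¹ := by
  have hs : ∀ a : ℝ, Real.sqrt (Real.exp a) = Real.exp (a / 2) := fun a => (Real.exp_half a).symm
  have he : ∀ a : ℝ, Real.exp a = Real.exp (a / 2) ^ 2 := fun a => by
    rw [← Real.exp_nat_mul]; ring_nf
  rw [hs, hs, he u, he w, Real.cosh_eq, show (w - u) / 2 = w / 2 - u / 2 by ring,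
    neg_sub, Real.exp_sub, Real.exp_sub]
  have h1 := Real.exp_pos (u / 2)
  have h2 := Real.exp_pos (w / 2)
  have h3 := Real.pi_pos
  generalize Real.exp (u / 2) = p at *
  generalize Real.exp (w / 2) = q at *
  have : p ^ 2 + q ^ 2 ≠ 0 := by positivity
  have : q ^ 2 + p ^ 2 ≠ 0 := by positivity
  field_simp
  ring

theorem inner_carleman_isTestPos {g h : ℝ → ℝ} (hg : IsTestPos g) (hh : IsTestPos h) :
    inner ℂ hh.toL2Pos (carleman hg.toL2Pos) =
      inner ℂ (mellinL2 hh.toL2Pos) (mulSech (mellinL2 hg.toL2Pos)) := by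
  have hB : carleman hg.toL2Pos =ᵐ[volume.restrict (Set.Ioi 0)] fun s : ℝ =>
      ((2 * Real.pi : ℝ) : ℂ)⁻¹ * ∫ v in Set.Ioi (0 : ℝ), (g v : ℂ) * ((s + v : ℝ) : ℂ)⁻¹ := by
    have : carleman hg.toL2Pos =
      (-Complex.I) • truncatedFourier (truncatedFourier hg.toL2Pos) := rfl
    rw [this]
    filter_upwards [Lp.coeFn_smul (-Complex.I) (truncatedFourier (truncatedFourier hg.toL2Pos)),
      hg.truncatedFourier_truncatedFourier_toL2Pos] with s h1 h2
    rw [h1, Pi.smul_apply, h2, smul_eq_mul, ← mul_assoc, ← mul_assoc, neg_mul, Complex.I_mul_I,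
      neg_neg, one_mul]
  have hl : inner ℂ hh.toL2Pos (carleman hg.toL2Pos) = ∫ u : ℝ,
      ((Real.sqrt (Real.exp u) * h (Real.exp u) : ℝ) : ℂ) * ∫ w : ℝ,
        ((Real.sqrt (Real.exp w) * g (Real.exp w) : ℝ) : ℂ) *
          ((4 * Real.pi * Real.cosh ((w - u) / 2))⁻¹ : ℝ) := by
    rw [L2.inner_def]
    have e1 : ∫ s in Set.Ioi (0 : ℝ), inner ℂ (hh.toL2Pos s) (carleman hg.toL2Pos s) =
        ∫ s in Set.Ioi (0 : ℝ), (h s : ℂ) * (((2 * Real.pi : ℝ) : ℂ)⁻¹ *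
          ∫ v in Set.Ioi (0 : ℝ), (g v : ℂ) * ((s + v : ℝ) : ℂ)⁻¹) := by
      refine integral_congr_ae ?_
      filter_upwards [hB, hh.coeFn_toL2Pos] with s h1 h2
      rw [h1, h2, RCLike.inner_apply, Complex.conj_ofReal, mul_comm]
    rw [e1, integral_Ioi_eq_integral_exp]
    refine integral_congr_ae (Eventually.of_forall fun u => ?_)
    simp only
    rw [integral_Ioi_eq_integral_exp, ← integral_const_mul, ← integral_const_mul,
      ← integral_const_mul, ← integral_const_mul]
    refine integral_congr_ae (Eventually.of_forall fun w => ?_)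
    have := congrArg (fun r : ℝ => (r : ℂ)) (exp_mul_exp_div u w)
    push_cast at this ⊢
    linear_combination (h (Real.exp u) : ℂ) * (g (Real.exp w) : ℂ) * this
  rw [hl, ← fourier_form_sechSymbol hh.integrable_exp_comp hg.integrable_exp_comp
    fun u => Complex.conj_ofReal _, L2.inner_def]
  refine integral_congr_ae ?_
  filter_upwards [coeFn_mulSech (mellinL2 hg.toL2Pos), hg.mellinL2_toL2Pos,
    hh.mellinL2_toL2Pos] with v h1 h2 h3
  rw [h1, h2, h3, RCLike.inner_apply]

theorem mellinL2_carleman (x : L2Pos) : mellinL2 (carleman x) = mulSech (mellinL2 x) := by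
  have hop : carleman = (mellinL2.symm.toContinuousLinearEquiv : L2Real →L[ℂ] L2Pos) ∘L mulSech ∘L
      (mellinL2.toContinuousLinearEquiv : L2Pos →L[ℂ] L2Real) := by
    refine ContinuousLinearMap.ext_on dense_span_isTestPos ?_
    rintro _ ⟨g, hg, rfl⟩
    refine sub_eq_zero.1 (eq_zero_of_inner_isTestPos fun h hh => ?_)
    rw [inner_sub_right, inner_carleman_isTestPos hg hh, ← mellinL2.inner_map_map]
    simp
  have := congrArg (fun T : L2Pos →L[ℂ] L2Pos => mellinL2 (T x)) hop
  simpa using this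

/-- `cosh` determines its argument up to sign, so each level set has at most two points. -/
theorem volume_sechSymbol_eq (c : ℂ) : volume {v : ℝ | (sechSymbol v : ℂ) = c} = 0 := by
  refine Set.Finite.measure_zero ?_ _
  by_cases h : ∃ v₀ : ℝ, (sechSymbol v₀ : ℂ) = c
  · obtain ⟨v₀, h₀⟩ := h
    refine (Set.toFinite {v₀, -v₀}).subset fun v hv => ?_
    have h1 : sechSymbol v = sechSymbol v₀ := by
      have : (sechSymbol v : ℂ) = (sechSymbol v₀ : ℂ) := by rw [h₀]; exact hv
      exact_mod_cast this
    have h2 : |2 * Real.pi ^ 2 * v| = |2 * Real.pi ^ 2 * v₀| := by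
      unfold sechSymbol at h1
      have h3 := mul_left_cancel₀ two_ne_zero (inv_injective h1)
      exact le_antisymm (Real.cosh_le_cosh.1 h3.le) (Real.cosh_le_cosh.1 h3.ge)
    rw [abs_mul _ v, abs_mul _ v₀] at h2
    have h4 := mul_left_cancel₀ (by positivity : |2 * Real.pi ^ 2| ≠ 0) h2
    exact abs_eq_abs.1 h4
  · convert Set.finite_empty
    exact Set.eq_empty_of_forall_notMem fun v hv => h ⟨v, hv⟩

theorem eq_zero_of_carleman_eq_smul (c : ℂ) (x : L2Pos) (hx : carleman x = c • x) : x = 0 := by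
  have h := mellinL2_carleman x
  rw [hx, map_smul] at h
  have hz : mellinL2 x = 0 := by
    rw [Lp.eq_zero_iff_ae_eq_zero]
    have hne : ∀ᵐ v : ℝ, (sechSymbol v : ℂ) ≠ c := by
      simpa [ae_iff] using volume_sechSymbol_eq c
    filter_upwards [coeFn_mulSech (mellinL2 x), Lp.coeFn_smul c (mellinL2 x), hne] with v h1 h2 h3
    rw [← h, h2, Pi.smul_apply, smul_eq_mul] at h1
    have : (c - sechSymbol v) * mellinL2 x v = 0 := by rw [sub_mul, h1, sub_self]
    exact (mul_eq_zero.1 this).resolve_left (sub_ne_zero.2 h3.symm)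
  simpa using hz

end MellinModel

/-! ### The spectrum of the Carleman operator -/

section CarlemanSpectrum

open scoped ComplexOrder

theorem inner_mulSech_left (f g : L2Real) : inner ℂ (mulSech f) g = inner ℂ f (mulSech g) := by
  rw [L2.inner_def, L2.inner_def]
  refine integral_congr_ae ?_
  filter_upwards [coeFn_mulSech f, coeFn_mulSech g] with v h1 h2
  rw [h1, h2, RCLike.inner_apply, RCLike.inner_apply, map_mul, Complex.conj_ofReal]
  ring

theorem re_inner_mulSech_nonneg (f : L2Real) : 0 ≤ (inner ℂ (mulSech f) f).re := by
  have h : (inner ℂ (mulSech f) f).re = ∫ v, sechSymbol v * ‖f v‖ ^ 2 := by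
    rw [L2.inner_def]
    have : ∫ v, inner ℂ (mulSech f v) (f v) = ∫ v, ((sechSymbol v * ‖f v‖ ^ 2 : ℝ) : ℂ) := by
      refine integral_congr_ae ?_
      filter_upwards [coeFn_mulSech f] with v h1
      rw [h1, RCLike.inner_apply, map_mul, Complex.conj_ofReal, mul_left_comm, Complex.mul_conj']
      push_cast; rfl
    rw [this, integral_complex_ofReal]
    exact Complex.ofReal_re _
  rw [h]
  exact integral_nonneg fun v => mul_nonneg (sechSymbol_pos v).le (sq_nonneg _)

theorem norm_mulSech_le (f : L2Real) : ‖mulSech f‖ ≤ 1 / 2 * ‖f‖ := by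
  refine Lp.norm_le_mul_norm_of_ae_le_mul ?_
  filter_upwards [coeFn_mulSech f] with v hv
  rw [hv, norm_mul, Complex.norm_real, Real.norm_eq_abs, abs_of_pos (sechSymbol_pos v)]
  exact mul_le_mul_of_nonneg_right (sechSymbol_le v) (norm_nonneg _)

theorem isPositive_carleman : carleman.IsPositive := by
  refine (ContinuousLinearMap.isPositive_iff _).2 ⟨fun x y => ?_, fun x => ?_⟩
  · change inner ℂ (carleman x) y = inner ℂ x (carleman y)
    rw [← mellinL2.inner_map_map, ← mellinL2.inner_map_map x, mellinL2_carleman, mellinL2_carleman,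
      inner_mulSech_left]
  · rw [← mellinL2.inner_map_map, mellinL2_carleman, Complex.nonneg_iff]
    refine ⟨re_inner_mulSech_nonneg _, ?_⟩
    have h := inner_conj_symm (𝕜 := ℂ) (mulSech (mellinL2 x)) (mellinL2 x)
    rw [← inner_mulSech_left] at h
    exact (Complex.conj_eq_iff_im.1 h).symm

theorem norm_carleman_le : ‖carleman‖ ≤ 1 / 2 :=
  ContinuousLinearMap.opNorm_le_bound _ (by norm_num) fun x => by
    rw [← mellinL2.norm_map, mellinL2_carleman, ← mellinL2.norm_map x]
    exact norm_mulSech_le _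

theorem exists_sechSymbol_eq {c : ℝ} (hc : c ∈ Set.Ioc (0 : ℝ) (1 / 2)) :
    ∃ v, sechSymbol v = c := by
  have h1 : 1 ≤ (2 * c)⁻¹ := (one_le_inv₀ (by linarith [hc.1])).2 (by linarith [hc.2])
  refine ⟨(2 * Real.pi ^ 2)⁻¹ * Real.arcosh (2 * c)⁻¹, ?_⟩
  have : (2 * Real.pi ^ 2 : ℝ) ≠ 0 := by positivity
  rw [sechSymbol, mul_inv_cancel_left₀ this, Real.cosh_arcosh h1]
  have := hc.1.ne'
  field_simp

/-- Indicators of small neighbourhoods of `v₀` are approximate eigenvectors of the multiplication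
operator, which no bounded inverse tolerates. -/
theorem sechSymbol_mem_spectrum_carleman (v₀ : ℝ) :
    (sechSymbol v₀ : ℂ) ∈ spectrum ℂ carleman := by
  intro hu
  obtain ⟨S, hS⟩ := hu.exists_left_inv
  obtain ⟨c, hc⟩ : ∃ c : ℂ, c = ((sechSymbol v₀ : ℝ) : ℂ) := ⟨_, rfl⟩
  rw [← hc] at hS
  have hbdd : ∀ f : L2Real, ‖f‖ ≤ ‖S‖ * ‖c • f - mulSech f‖ := by
    intro f
    have h1 : S (c • mellinL2.symm f - carleman (mellinL2.symm f)) = mellinL2.symm f := by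
      have := congrArg (fun T : L2Pos →L[ℂ] L2Pos => T (mellinL2.symm f)) hS
      simpa [Algebra.algebraMap_eq_smul_one] using this
    have h2 : mellinL2 (c • mellinL2.symm f - carleman (mellinL2.symm f)) = c • f - mulSech f := by
      rw [map_sub, map_smul, mellinL2_carleman, mellinL2.apply_symm_apply]
    calc ‖f‖ = ‖S (c • mellinL2.symm f - carleman (mellinL2.symm f))‖ := by
          rw [h1, mellinL2.symm.norm_map]
      _ ≤ ‖S‖ * ‖c • mellinL2.symm f - carleman (mellinL2.symm f)‖ := S.le_opNorm _
      _ = _ := by rw [← h2, mellinL2.norm_map]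
  -- Chosen so that `‖S‖ * δ < 1`, which contradicts the lower bound `hbdd`.
  set δ : ℝ := (2 * (‖S‖ + 1))⁻¹ with hδ
  have hS0 := norm_nonneg S
  have hδ0 : 0 < δ := by positivity
  -- The ball only serves to make the measure finite, so that the indicator is in `L²`.
  set s : Set ℝ := {v | |sechSymbol v - sechSymbol v₀| < δ} ∩ Metric.ball v₀ 1 with hs
  have hso : IsOpen s :=
    (isOpen_lt (by have := continuous_sechSymbol; fun_prop) continuous_const).inter
      Metric.isOpen_ball
  have hpos : 0 < volume s := hso.measure_pos volume ⟨v₀, by simpa using hδ0, by simp⟩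
  have hfin : volume s ≠ ⊤ :=
    ((measure_mono Set.inter_subset_right).trans_lt measure_ball_lt_top).ne
  set f : L2Real := indicatorConstLp 2 hso.measurableSet hfin (1 : ℂ) with hf
  have hfn : 0 < ‖f‖ := by
    rw [hf, norm_indicatorConstLp two_ne_zero ENNReal.ofNat_ne_top, norm_one, one_mul]
    exact Real.rpow_pos_of_pos (ENNReal.toReal_pos hpos.ne' hfin) _
  have hle : ‖c • f - mulSech f‖ ≤ δ * ‖f‖ := by
    refine Lp.norm_le_mul_norm_of_ae_le_mul ?_
    filter_upwards [coeFn_mulSech f, Lp.coeFn_smul c f, Lp.coeFn_sub (c • f) (mulSech f),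
      indicatorConstLp_coeFn (p := 2) (hs := hso.measurableSet) (hμs := hfin) (c := (1 : ℂ))]
      with v h1 h2 h3 h4
    rw [h3, Pi.sub_apply, h2, h1, Pi.smul_apply, smul_eq_mul, ← sub_mul, norm_mul, hf, h4]
    by_cases hv : v ∈ s
    · refine mul_le_mul_of_nonneg_right ?_ (norm_nonneg _)
      rw [hc, ← Complex.ofReal_sub, Complex.norm_real, Real.norm_eq_abs, abs_sub_comm]
      exact hv.1.le
    · simp [hv]
  have h1 := (hbdd f).trans (mul_le_mul_of_nonneg_left hle hS0)
  have h2 : ‖S‖ * δ < 1 := by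
    rw [hδ, ← div_eq_mul_inv, div_lt_one (by positivity)]
    linarith
  nlinarith

theorem spectrum_carleman :
    spectrum ℂ carleman = (fun c : ℝ => (c : ℂ)) '' Set.Icc 0 (1 / 2) := by
  have hsa : IsSelfAdjoint carleman := isPositive_carleman.isSelfAdjoint
  have hnn : 0 ≤ carleman := ContinuousLinearMap.nonneg_iff_isPositive _ |>.2 isPositive_carleman
  refine Set.Subset.antisymm (fun z hz => ?_) ?_
  · have hre := hsa.mem_spectrum_eq_re hz
    have h0 : 0 ≤ z := spectrum_nonneg_of_nonneg hnn hz
    have h1 : ‖z‖ ≤ 1 / 2 := by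
      refine (spectrum.norm_le_norm_mul_of_mem hz).trans ?_
      refine (mul_le_mul norm_carleman_le ContinuousLinearMap.norm_id_le (norm_nonneg _)
        (by norm_num)).trans (by norm_num)
    exact ⟨z.re, ⟨(Complex.nonneg_iff.1 h0).1, (Complex.re_le_norm z).trans h1⟩, hre.symm⟩
  -- The symbol never takes the value `0`, so that point enters only through closedness.
  · have hcl : IsClosed ((fun c : ℝ => (c : ℂ)) ⁻¹' spectrum ℂ carleman) :=
      (spectrum.isClosed carleman).preimage Complex.continuous_ofReal
    have hsub : Set.Ioo (0 : ℝ) (1 / 2) ⊆ (fun c : ℝ => (c : ℂ)) ⁻¹' spectrum ℂ carleman := by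
      intro c hc
      obtain ⟨v, hv⟩ := exists_sechSymbol_eq ⟨hc.1, hc.2.le⟩
      have := sechSymbol_mem_spectrum_carleman v
      rwa [hv] at this
    have h := hcl.closure_subset_iff.2 hsub
    rw [closure_Ioo (by norm_num)] at h
    exact Set.image_subset_iff.2 h

end CarlemanSpectrum

/-! ### Relations inherited from the Fourier operator on the line -/

section Unitary

open scoped InnerProductSpace

theorem inner_extendL2_left (x : L2Pos) (f : L2Real) :
    inner ℂ (extendL2 x) f = inner ℂ x (restrictL2 f) := by
  rw [L2.inner_def, L2.inner_def, ← integral_indicator measurableSet_Ioi]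
  have h1 : (extendL2 x : ℝ → ℂ) =ᵐ[volume] (Set.Ioi (0 : ℝ)).indicator x :=
    (memLp_extend x).coeFn_toLp
  have h2 := (ae_restrict_iff' measurableSet_Ioi).1 (LpToLpRestrictCLM_coeFn ℂ (Set.Ioi 0) f)
  refine integral_congr_ae ?_
  filter_upwards [h1, h2] with t ht1 ht2
  rw [ht1]
  by_cases ht : t ∈ Set.Ioi (0 : ℝ)
  · rw [Set.indicator_of_mem ht, Set.indicator_of_mem ht]
    exact congrArg _ (ht2 ht).symm
  · rw [Set.indicator_of_notMem ht, Set.indicator_of_notMem ht, inner_zero_left]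

theorem adjoint_extendL2 :
    ContinuousLinearMap.adjoint extendL2.toContinuousLinearMap = restrictL2 := by
  refine (ContinuousLinearMap.eq_adjoint_iff _ _).2 (fun f x => ?_) |>.symm
  rw [← inner_conj_symm, ← inner_extendL2_left, inner_conj_symm]
  rfl

theorem restrictL2_extendL2 (x : L2Pos) : restrictL2 (extendL2 x) = x := by
  refine ext_inner_left ℂ fun y => ?_
  rw [← inner_extendL2_left, extendL2.inner_map_map]

/-- The reflection `f ↦ (t ↦ f(-t))` of `L²(ℝ)`. -/
def reflectL2 : L2Real →L[ℂ] L2Real :=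
  (Lp.compMeasurePreservingₗᵢ ℂ (fun t : ℝ => -t)
    (Measure.measurePreserving_neg volume)).toContinuousLinearMap

theorem coeFn_reflectL2 (f : L2Real) : reflectL2 f =ᵐ[volume] fun t => f (-t) :=
  Lp.coeFn_compMeasurePreserving f (Measure.measurePreserving_neg volume)

theorem reflectL2_reflectL2 (f : L2Real) : reflectL2 (reflectL2 f) = f := by
  refine Lp.ext ?_
  filter_upwards [coeFn_reflectL2 (reflectL2 f),
    (Measure.measurePreserving_neg (volume : Measure ℝ)).quasiMeasurePreserving.ae
      (coeFn_reflectL2 f)] with t h1 h2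
  rw [h1, h2, neg_neg]

theorem coeFn_extendL2_restrictL2 (f : L2Real) :
    extendL2 (restrictL2 f) =ᵐ[volume] (Set.Ioi (0 : ℝ)).indicator f := by
  have h1 : (extendL2 (restrictL2 f) : ℝ → ℂ) =ᵐ[volume]
      (Set.Ioi (0 : ℝ)).indicator (restrictL2 f) := (memLp_extend (restrictL2 f)).coeFn_toLp
  have h2 := (ae_restrict_iff' measurableSet_Ioi).1 (LpToLpRestrictCLM_coeFn ℂ (Set.Ioi 0) f)
  filter_upwards [h1, h2] with t ht1 ht2
  rw [ht1]
  by_cases ht : t ∈ Set.Ioi (0 : ℝ)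
  · rw [Set.indicator_of_mem ht, Set.indicator_of_mem ht]
    exact ht2 ht
  · rw [Set.indicator_of_notMem ht, Set.indicator_of_notMem ht]

theorem extendL2_restrictL2_add_reflect (f : L2Real) :
    extendL2 (restrictL2 f) + reflectL2 (extendL2 (restrictL2 (reflectL2 f))) = f := by
  refine Lp.ext ?_
  have hq := (Measure.measurePreserving_neg (volume : Measure ℝ)).quasiMeasurePreserving
  have h0 : ∀ᵐ t : ℝ, t ≠ 0 := by simp [ae_iff]
  filter_upwards [Lp.coeFn_add (extendL2 (restrictL2 f))
      (reflectL2 (extendL2 (restrictL2 (reflectL2 f)))), coeFn_extendL2_restrictL2 f,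
    coeFn_reflectL2 (extendL2 (restrictL2 (reflectL2 f))),
    hq.ae (coeFn_extendL2_restrictL2 (reflectL2 f)), hq.ae (coeFn_reflectL2 f), h0]
    with t h1 h2 h3 h4 h5 h6
  rw [h1, Pi.add_apply, h2, h3, h4]
  rcases lt_or_gt_of_ne h6 with ht | ht
  · rw [Set.indicator_of_notMem (by simpa using ht.le), Set.indicator_of_mem (by simpa using ht),
      h5, neg_neg, zero_add]
  · rw [Set.indicator_of_mem (by simpa using ht), Set.indicator_of_notMem (by simpa using ht.le),
      add_zero]

theorem fourierOp_ae (f : L2Real) (hf : Integrable f) :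
    fourierOp f =ᵐ[volume] fun t : ℝ => ((Real.sqrt (2 * Real.pi))⁻¹ : ℂ) *
      𝓕⁻ (f : ℝ → ℂ) ((2 * Real.pi)⁻¹ * t) := by
  have h2 : fourierOp f =ᵐ[volume] fun t : ℝ => ((Real.sqrt (2 * Real.pi))⁻¹ : ℂ) *
      (𝓕⁻ f : L2Real) ((2 * Real.pi)⁻¹ * t) :=
    (memLp_scale (𝓕⁻ f)).coeFn_toLp
  filter_upwards [h2, quasiMeasurePreserving_scale.ae (fourierInv_ae f hf)] with t h3 h4
  rw [h3, h4]

theorem fourierInv_congr_ae {f g : ℝ → ℂ} (h : f =ᵐ[volume] g) : 𝓕⁻ f = 𝓕⁻ g := by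
  funext t
  rw [Real.fourierInv_eq', Real.fourierInv_eq']
  refine integral_congr_ae ?_
  filter_upwards [h] with v hv
  rw [hv]

/-- The Jacobian `2π` of the inner dilation cancels the two factors `(2π)^{-1/2}`. The rescaled
transform thus has the same square as the one with kernel `e^{2πitξ}`. -/
theorem fourierInv_scaled (f : ℝ → ℂ) (t : ℝ) :
    ((Real.sqrt (2 * Real.pi))⁻¹ : ℂ) * 𝓕⁻ (fun u : ℝ => ((Real.sqrt (2 * Real.pi))⁻¹ : ℂ) *
      f ((2 * Real.pi)⁻¹ * u)) ((2 * Real.pi)⁻¹ * t) = 𝓕⁻ f t := by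
  have hpi : (0 : ℝ) < 2 * Real.pi := by positivity
  have hcv := Measure.integral_comp_mul_left (fun u : ℝ =>
    Complex.exp (((2 * Real.pi * inner ℝ u t : ℝ) : ℂ) * Complex.I) • f u) (2 * Real.pi)⁻¹
  rw [inv_inv, abs_of_pos hpi, Complex.real_smul] at hcv
  have hsq : ((Real.sqrt (2 * Real.pi) : ℝ) : ℂ) * (Real.sqrt (2 * Real.pi) : ℝ) =
      ((2 * Real.pi : ℝ) : ℂ) := by
    rw [← Complex.ofReal_mul, Real.mul_self_sqrt hpi.le]
  have hne : ((2 * Real.pi : ℝ) : ℂ) ≠ 0 := by exact_mod_cast hpi.ne'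
  have hs0 : ((Real.sqrt (2 * Real.pi) : ℝ) : ℂ) ≠ 0 := by
    exact_mod_cast (Real.sqrt_pos.2 hpi).ne'
  refine mul_left_cancel₀ hne ?_
  rw [Real.fourierInv_eq', Real.fourierInv_eq', ← hcv, ← hsq, ← integral_const_mul,
    ← integral_const_mul]
  refine integral_congr_ae (Filter.Eventually.of_forall fun u => ?_)
  have e : (inner ℝ u ((2 * Real.pi)⁻¹ * t) : ℝ) = inner ℝ ((2 * Real.pi)⁻¹ * u) t := by
    simp only [RCLike.inner_apply, conj_trivial]; ring
  simp only [smul_eq_mul]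
  rw [e]
  generalize Complex.exp _ = z
  generalize f _ = y
  field_simp

theorem fourierOp_fourierOp_of_ae {f : L2Real} {φ : SchwartzMap ℝ ℂ} (hφ : f =ᵐ[volume] φ) :
    fourierOp (fourierOp f) = reflectL2 f := by
  have h1 := fourierOp_ae f (φ.integrable.congr hφ.symm)
  rw [fourierInv_congr_ae hφ] at h1
  have hint : Integrable fun t : ℝ => ((Real.sqrt (2 * Real.pi))⁻¹ : ℂ) *
      𝓕⁻ (φ : ℝ → ℂ) ((2 * Real.pi)⁻¹ * t) := by
    have h := ((𝓕⁻ φ).integrable (μ := volume)).comp_mul_left' (R := (2 * Real.pi)⁻¹)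
      (by positivity)
    rw [SchwartzMap.fourierInv_coe] at h
    exact h.const_mul _
  have h2 := fourierOp_ae (fourierOp f) (hint.congr h1.symm)
  rw [fourierInv_congr_ae h1] at h2
  have hinv : ∀ t, 𝓕⁻ (𝓕⁻ (φ : ℝ → ℂ)) t = φ (-t) := by
    intro t
    rw [Real.fourierInv_eq_fourier_neg, ← SchwartzMap.fourierInv_coe,
      ← SchwartzMap.fourier_coe, FourierTransform.fourier_fourierInv_eq]
  refine Lp.ext ?_
  filter_upwards [h2, coeFn_reflectL2 f,
    (Measure.measurePreserving_neg (volume : Measure ℝ)).quasiMeasurePreserving.ae hφ]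
    with t h3 h4 h5
  rw [h3, h4, h5, fourierInv_scaled, hinv]

/-- Fourier inversion on Schwartz functions, extended by density and continuity. -/
theorem fourierOp_fourierOp (f : L2Real) : fourierOp (fourierOp f) = reflectL2 f := by
  have h := (SchwartzMap.denseRange_toLpCLM (E := ℝ) (F := ℂ) (μ := volume) (p := 2)
    ENNReal.ofNat_ne_top).equalizer
    (g := fun f => fourierOp (fourierOp f)) (h := fun f => reflectL2 f)
    (by fun_prop) (by fun_prop) (funext fun φ => fourierOp_fourierOp_of_ae (φ.coeFn_toLp 2 volume))
  exact congrFun h f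

theorem norm_fourierOp (f : L2Real) : ‖fourierOp f‖ = ‖f‖ :=
  (scaleL2.norm_map _).trans ((Lp.fourierTransformₗᵢ ℝ ℂ).symm.norm_map f)

theorem reflectL2_fourierOp (f : L2Real) : reflectL2 (fourierOp f) = fourierOp (reflectL2 f) := by
  rw [← fourierOp_fourierOp, ← fourierOp_fourierOp]

/-- An isometry has its adjoint as left inverse. Since the square is the reflection, an involution,
`reflectL2 ∘L fourierOp` is a right inverse, and the two coincide. -/
theorem adjoint_fourierOp : ContinuousLinearMap.adjoint fourierOp = reflectL2 ∘L fourierOp := by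
  have h1 : ContinuousLinearMap.adjoint fourierOp ∘L fourierOp = 1 :=
    (ContinuousLinearMap.norm_map_iff_adjoint_comp_self _).1 norm_fourierOp
  have h2 : fourierOp ∘L (reflectL2 ∘L fourierOp) = 1 := by
    ext1 f
    simp only [ContinuousLinearMap.comp_apply]
    rw [← reflectL2_fourierOp, fourierOp_fourierOp, reflectL2_reflectL2]
    rfl
  calc ContinuousLinearMap.adjoint fourierOp
      = ContinuousLinearMap.adjoint fourierOp ∘L (fourierOp ∘L (reflectL2 ∘L fourierOp)) := by
        rw [h2]; rfl
    _ = (ContinuousLinearMap.adjoint fourierOp ∘L fourierOp) ∘L (reflectL2 ∘L fourierOp) := rfl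
    _ = _ := by rw [h1]; rfl

theorem adjoint_truncatedFourier : ContinuousLinearMap.adjoint truncatedFourier =
    restrictL2 ∘L (reflectL2 ∘L fourierOp) ∘L extendL2.toContinuousLinearMap := by
  rw [truncatedFourier, ContinuousLinearMap.adjoint_comp, ContinuousLinearMap.adjoint_comp,
    adjoint_fourierOp, adjoint_extendL2, ← adjoint_extendL2, ContinuousLinearMap.adjoint_adjoint]
  rfl

/-- With `f` the full transform of `x`, the two products insert between two Fourier operators the
parts of `f` on the positive and on the negative half-line. Together these parts make up `f`, and
the truncation disappears. -/
theorem adjoint_mul_self_add_mul_adjoint :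
    star truncatedFourier * truncatedFourier + truncatedFourier * star truncatedFourier = 1 := by
  rw [ContinuousLinearMap.star_eq_adjoint, adjoint_truncatedFourier]
  ext1 x
  obtain ⟨f, hf⟩ : ∃ f, f = fourierOp (extendL2 x) := ⟨_, rfl⟩
  have h := extendL2_restrictL2_add_reflect f
  change restrictL2 (reflectL2 (fourierOp (extendL2 (restrictL2 (fourierOp (extendL2 x)))))) +
    restrictL2 (fourierOp (extendL2 (restrictL2 (reflectL2 (fourierOp (extendL2 x)))))) = x
  rw [← hf]
  -- Written this way, both summands have the common left factor `restrictL2 ∘ reflectL2 ∘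
  -- fourierOp`.
  have h2 : fourierOp (extendL2 (restrictL2 (reflectL2 f))) =
      reflectL2 (fourierOp (reflectL2 (extendL2 (restrictL2 (reflectL2 f))))) := by
    rw [reflectL2_fourierOp, reflectL2_reflectL2]
  rw [h2, ← map_add, ← map_add, ← map_add, h, hf, fourierOp_fourierOp, reflectL2_reflectL2,
    restrictL2_extendL2]

end Unitary

/-! ### Assembly of the two spectra -/

section Main

theorem truncatedFourier_mul_self :
    truncatedFourier * truncatedFourier = Complex.I • carleman := by
  rw [carleman, smul_smul, mul_neg, Complex.I_mul_I, neg_neg, one_smul]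

theorem star_truncatedFourier_mul_self :
    star truncatedFourier * star truncatedFourier = (-Complex.I) • carleman := by
  have h : star carleman = carleman := isPositive_carleman.isSelfAdjoint
  rw [← star_mul, truncatedFourier_mul_self, star_smul, h]
  congr 1
  exact Complex.conj_I

theorem two_rpow_mul_exp_sq (z : ℂ) :
    (((2 : ℝ) ^ (-(1 / 2) : ℝ) : ℝ) * Complex.exp (z * Real.pi / 4)) ^ 2 =
      Complex.exp (Real.pi / 2 * z) / 2 := by
  have h1 : (((2 : ℝ) ^ (-(1 / 2) : ℝ) : ℝ) : ℂ) ^ 2 = 1 / 2 := by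
    rw [← Complex.ofReal_pow, ← Real.rpow_natCast, ← Real.rpow_mul (by norm_num)]
    norm_num [Real.rpow_neg_one]
  rw [mul_pow, h1, ← Complex.exp_nat_mul]
  push_cast
  rw [show (2 * (z * Real.pi / 4) : ℂ) = Real.pi / 2 * z by ring]
  ring

end Main

end

theorem mainTheorem2 :
    (spectrum ℂ truncatedFourier =
        segment ℝ (-(((2 : ℝ) ^ (-(1 / 2) : ℝ) : ℝ) * Complex.exp (Complex.I * Real.pi / 4)))
          (((2 : ℝ) ^ (-(1 / 2) : ℝ) : ℝ) * Complex.exp (Complex.I * Real.pi / 4)) ∧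
      pointSpectrum truncatedFourier = ∅ ∧
      residualSpectrum truncatedFourier = ∅ ∧
      spectrum ℂ truncatedFourier = continuousSpectrum truncatedFourier) ∧
    (spectrum ℂ (ContinuousLinearMap.adjoint truncatedFourier) =
        segment ℝ (-(((2 : ℝ) ^ (-(1 / 2) : ℝ) : ℝ) * Complex.exp (-Complex.I * Real.pi / 4)))
          (((2 : ℝ) ^ (-(1 / 2) : ℝ) : ℝ) * Complex.exp (-Complex.I * Real.pi / 4)) ∧
      pointSpectrum (ContinuousLinearMap.adjoint truncatedFourier) = ∅ ∧
      residualSpectrum (ContinuousLinearMap.adjoint truncatedFourier) = ∅ ∧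
      spectrum ℂ (ContinuousLinearMap.adjoint truncatedFourier) =
        continuousSpectrum (ContinuousLinearMap.adjoint truncatedFourier)) := by
  have e1 := two_rpow_mul_exp_sq Complex.I
  rw [Complex.exp_pi_div_two_mul_I] at e1
  have e2 := two_rpow_mul_exp_sq (-Complex.I)
  rw [mul_neg, Complex.exp_neg, Complex.exp_pi_div_two_mul_I, Complex.inv_I] at e2
  have hA := truncatedFourier_mul_self
  have hA' := star_truncatedFourier_mul_self
  have h1 := adjoint_mul_self_add_mul_adjoint
  rw [← ContinuousLinearMap.star_eq_adjoint]
  have hI : Complex.I ≠ 0 := Complex.I_ne_zero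
  -- The endpoint `e` satisfies `2e² = i` for the operator and `2e² = -i` for its adjoint, which are
  -- the factors relating their squares to `carleman`. In both cases `e⁴ = -1/4`.
  refine ⟨⟨spectrum_eq_segment (B := carleman) ?_ ?_ h1 ?_ spectrum_carleman,
      spectrum_parts_of_sq hI (neg_ne_zero.2 hI) hA hA' eq_zero_of_carleman_eq_smul⟩,
    ⟨spectrum_eq_segment (B := carleman) ?_ ?_ ?_ ?_ spectrum_carleman,
      spectrum_parts_of_sq (neg_ne_zero.2 hI) hI hA' (by rw [star_star, hA])
        eq_zero_of_carleman_eq_smul⟩⟩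
  · rw [show 4 = 2 * 2 from rfl, pow_mul, e1, div_pow, Complex.I_sq]; norm_num
  · rw [hA, e1, mul_div_cancel₀ _ two_ne_zero]
  · rw [hA, hA', neg_smul]
  · rw [show 4 = 2 * 2 from rfl, pow_mul, e2, div_pow, neg_sq, Complex.I_sq]; norm_num
  · rw [hA', e2, mul_div_cancel₀ _ two_ne_zero]
  · rw [star_star, add_comm]; exact h1
  · rw [star_star, hA, hA', neg_smul, neg_neg]
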